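/- Let $m\ge 1$, let $[m]=\{1,\dots,m\}$, and let $K$ be an abstract simplicial complex on $[m]$, i.e. a family of subsets of $[m]$ that contains $\emptyset$ and is closed under passing to subsets (it is allowed, but not required, that every $\{i\}$ belongs to $K$). Let $$\mathcal Z_K=\bigcup_{\sigma\in K}\{z\in\mathbb C^m : |z_i|\le 1 \text{ for } i\in\sigma,\ |z_i|=1 \text{ for } i\notin\sigma\},$$ $$\mathbb R\mathcal Z_K=\bigcup_{\sigma\in K}\{x\in\mathbb R^m : |x_i|\le 1 \text{ for } i\in\sigma,\ |x_i|=1 \text{ for } i\notin\sigma\}$$ be the moment-angle complex and the real moment-angle complex of $K$. The torus $T^m=(S^1)^m$ acts on $\mathcal Z_K$, and the $2$-torus $(\mathbb Z_2)^m=\{\pm1\}^m$ acts on $\mathbb R\mathcal Z_K$, by coordinatewise multiplication. Let $\mathbf k$ be any field and $r\ge 0$ an integer. (a) If a subtorus $H\subseteq T^m$ of rank $r$ (a subgroup isomorphic, as a topological group, to $T^r$) acts freely on $\mathcal Z_K$ by restriction of the $T^m$-action, then $\sum_i\dim_{\mathbf k}H^i(\mathcal Z_K;\mathbf k)\ge 2^r$.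 (b) If a subgroup $H\subseteq(\mathbb Z_2)^m$ of rank $r$ (isomorphic to $(\mathbb Z_2)^r$) acts freely on $\mathbb R\mathcal Z_K$ by restriction of the $(\mathbb Z_2)^m$-action, then $\sum_i\dim_{\mathbf k}H^i(\mathbb R\mathcal Z_K;\mathbf k)\ge 2^r$. In particular, taking $\mathbf k$ of characteristic $0$ in (a) and of characteristic $2$ in (b), the Halperin–Carlsson conjecture holds for $\mathcal Z_K$ and $\mathbb R\mathcal Z_K$ under the restriction of these natural actions. -/

import Mathlib

universe u

noncomputable section

/-- For a pair `W ⊆ X` of subsets of `E`, the subspace `K(X, W) = ⋃_{σ ∈ K} B_σ(X, W)` of `E^m`,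
where `B_σ(X, W)` is the product with `i`-th factor `X` for `i ∈ σ` and `W` for `i ∉ σ`.
Faces in `PreAbstractSimplicialComplex` are nonempty by convention, so the empty simplex, which
belongs to every abstract simplicial complex, is put back by hand. Not every `{i}` has to be
a face. -/
def polyhedralProduct {m : ℕ} {E : Type*} (K : PreAbstractSimplicialComplex (Fin m))
    (X W : Set E) : Set (Fin m → E) :=
  ⋃ σ ∈ insert ∅ K.faces, {z | ∀ i, (i ∈ σ → z i ∈ X) ∧ (i ∉ σ → z i ∈ W)}

/-- The moment-angle complex `𝒵_K = K(D², S¹) ⊆ ℂ^m`. -/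
def momentAngle {m : ℕ} (K : PreAbstractSimplicialComplex (Fin m)) : Set (Fin m → ℂ) :=
  polyhedralProduct K (Metric.closedBall 0 1) (Metric.sphere 0 1)

/-- The real moment-angle complex `ℝ𝒵_K = K(D¹, S⁰) ⊆ ℝ^m`. -/
def realMomentAngle {m : ℕ} (K : PreAbstractSimplicialComplex (Fin m)) : Set (Fin m → ℝ) :=
  polyhedralProduct K (Metric.closedBall 0 1) (Metric.sphere 0 1)

theorem smul_mem_polyhedralProduct {m : ℕ} {E G : Type*} [SMul G E]
    (K : PreAbstractSimplicialComplex (Fin m)) {X W : Set E}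
    (hX : ∀ (g : G), ∀ x ∈ X, g • x ∈ X) (hW : ∀ (g : G), ∀ x ∈ W, g • x ∈ W)
    (g : Fin m → G) {z : Fin m → E} (hz : z ∈ polyhedralProduct K X W) :
    (fun i => g i • z i) ∈ polyhedralProduct K X W := by
  simp only [polyhedralProduct, Set.mem_iUnion, Set.mem_ofPred_eq] at hz ⊢
  obtain ⟨σ, hσ, h⟩ := hz
  exact ⟨σ, hσ, fun i => ⟨fun hi => hX _ _ ((h i).1 hi), fun hi => hW _ _ ((h i).2 hi)⟩⟩

theorem norm_intUnits_smul (g : ℤˣ) (x : ℝ) : ‖g • x‖ = ‖x‖ := by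
  rcases Int.units_eq_one_or g with rfl | rfl <;> simp [Units.smul_def]

/-- The natural action of the torus `T^m = (S¹)^m` on `𝒵_K`:
`(g₁, …, g_m) • (z₁, …, z_m) = (g₁ z₁, …, g_m z_m)`. -/
instance torusAction {m : ℕ} (K : PreAbstractSimplicialComplex (Fin m)) :
    MulAction (Fin m → Circle) (momentAngle K) where
  smul g z := ⟨fun i => g i • z.1 i, smul_mem_polyhedralProduct K
    (by simp [Circle.norm_smul]) (by simp [Circle.norm_smul]) g z.2⟩
  one_smul z := Subtype.ext (funext fun i => one_smul Circle (z.1 i))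
  mul_smul g h z := Subtype.ext (funext fun i => mul_smul (g i) (h i) (z.1 i))

/-- The natural action of the 2-torus `(ℤ₂)^m = {-1, 1}^m` on `ℝ𝒵_K`:
`(g₁, …, g_m) • (x₁, …, x_m) = (g₁ x₁, …, g_m x_m)`. -/
instance twoTorusAction {m : ℕ} (K : PreAbstractSimplicialComplex (Fin m)) :
    MulAction (Fin m → ℤˣ) (realMomentAngle K) where
  smul g x := ⟨fun i => g i • x.1 i, smul_mem_polyhedralProduct K
    (fun g y hy => by rw [mem_closedBall_zero_iff] at hy ⊢; rwa [norm_intUnits_smul])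
    (fun g y hy => by rw [mem_sphere_zero_iff_norm] at hy ⊢; rwa [norm_intUnits_smul]) g x.2⟩
  one_smul x := Subtype.ext (funext fun i => one_smul ℤˣ (x.1 i))
  mul_smul g h x := Subtype.ext (funext fun i => mul_smul (g i) (h i) (x.1 i))

/-- Singular cohomology `Hⁿ(X; k)`: the cohomology of the cochain complex
`Hom_k(C_•(X; k), k)`, where `C_•(X; k)` is the singular chain complex. -/
def singularCohomology (k : Type u) [Field k] (X : Type) [TopologicalSpace X] (n : ℕ) :
    ModuleCat.{u} k :=
  ((((AlgebraicTopology.singularChainComplexFunctor (ModuleCat.{u} k)).obj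
    (ModuleCat.of k k)).obj (TopCat.of X)).linearYonedaObj k (ModuleCat.of k k)).homology n

/-- The total dimension `∑ₙ dim_k Hⁿ(X; k)`, as a cardinal number. -/
def totalCohomologyDim (k : Type u) [Field k] (X : Type) [TopologicalSpace X] : Cardinal.{u} :=
  Cardinal.sum fun n : ℕ => Module.rank k (singularCohomology k X n)

end

/-!
Suppose that every line parallel to the `v`-axis meets `Z ⊆ ℝ^V` in `∅`, `{-1, 1}` or `[-1, 1]`.
Then `Z` is the double of its half `0 ≤ x v` along its slice `x v = 0`. Both halves are identified
with the face `x v = 1` by a map defined on all of `Z`, so in the Mayer–Vietoris sequence the kernel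
of the map from the homology of the slice to that of the face comes from `Z`, and its image is
bounded by the homology of the face, which is a direct summand of that of `Z`. Hence the total
homology of the slice is at most that of `Z`.

In a real moment-angle complex, slicing along all vertices of a maximal simplex `σ` leaves the
`2 ^ #σᶜ` isolated points whose coordinates vanish on `σ` and are `±1` off `σ`. The discs of an
arbitrary moment-angle complex are homeomorphic to cubes, and it becomes a real moment-angle complex
with `D` vertices in place of each vertex, where `D` is the dimension of the discs.

A free action of `H` has trivial isotropy at a point which vanishes exactly on `σ`, so `H` embeds
into the product of the coordinate groups off `σ`; comparing elements of order two gives `r ≤ #σᶜ`.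
-/

noncomputable section

open AlgebraicTopology CategoryTheory Limits ContinuousMap

section LinearAlgebra

variable {k : Type u} [Field k]

theorem rank_le_of_surjective_of_ker_le {P M N : Type u} [AddCommGroup P] [AddCommGroup M]
    [AddCommGroup N] [Module k P] [Module k M] [Module k N] (f : P →ₗ[k] M) (g : P →ₗ[k] N)
    (hg : Function.Surjective g) (h : LinearMap.ker f ≤ LinearMap.ker g) :
    Module.rank k N ≤ Module.rank k M :=
  calc Module.rank k N ≤ Module.rank k (P ⧸ LinearMap.ker f) :=
        LinearMap.rank_le_of_surjective ((LinearMap.ker f).liftQ g h) fun y =>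
          let ⟨x, hx⟩ := hg y
          ⟨Submodule.Quotient.mk x, hx⟩
    _ = Module.rank k (LinearMap.range f) := f.quotKerEquivRange.rank_eq
    _ ≤ Module.rank k M := Submodule.rank_le _

/-- The basis of a coproduct of copies of `k`, consisting of the units of the summands. -/
def coproductBasis {ι : Type} {c : Cofan fun _ : ι => ModuleCat.of k k} (hc : IsColimit c) :
    Module.Basis ι k c.pt :=
  .mk (v := fun i => c.inj i (1 : k))
    (by
      let φ : c.pt ⟶ ModuleCat.of k (ι →₀ k) :=
        Cofan.IsColimit.desc hc fun i => ModuleCat.ofHom (Finsupp.lsingle i)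
      have hφ : φ.hom ∘ (fun i => c.inj i (1 : k)) = fun i => Finsupp.single i (1 : k) :=
        funext fun i => LinearMap.congr_fun
          (congrArg ModuleCat.Hom.hom (Cofan.IsColimit.fac hc _ i)) (1 : k)
      exact .of_comp φ.hom (hφ ▸ Finsupp.linearIndependent_single_one k ι))
    (by
      rw [top_le_iff, ← Submodule.ker_mkQ (Submodule.span k _), LinearMap.ker_eq_top]
      refine congrArg ModuleCat.Hom.hom
        (Cofan.IsColimit.hom_ext hc (ModuleCat.ofHom (Submodule.mkQ _)) 0 fun i => ?_)
      ext
      simpa using! Submodule.subset_span (Set.mem_range_self i))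

theorem coproductBasis_apply {ι : Type} {c : Cofan fun _ : ι => ModuleCat.of k k}
    (hc : IsColimit c) (i : ι) : coproductBasis hc i = c.inj i (1 : k) :=
  Module.Basis.mk_apply ..

end LinearAlgebra

section Homology

variable {k : Type u} [Field k] {ι : Type*} {c : ComplexShape ι}
  {C D : HomologicalComplex (ModuleCat.{u} k) c}

theorem iCycles_injective (i : ι) : Function.Injective (C.iCycles i) :=
  (ModuleCat.mono_iff_injective _).1 inferInstance

theorem homologyπ_surjective (i : ι) : Function.Surjective (C.homologyπ i) :=
  (ModuleCat.epi_iff_surjective _).1 inferInstance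

theorem d_iCycles (i j : ι) (z : C.cycles i) : C.d i j (C.iCycles i z) = 0 :=
  congr($(C.iCycles_d i j) z)

theorem homologyπ_eq_zero_iff {i j : ι} (hij : c.prev i = j) (z : C.cycles i) :
    C.homologyπ i z = 0 ↔ ∃ y, C.d j i y = C.iCycles i z := by
  subst hij
  constructor
  · intro hz
    have hex := (ShortComplex.moduleCat_exact_iff
      (.mk (C.toCycles _ i) (C.homologyπ i) (C.toCycles_comp_homologyπ _ i))).1
      (ShortComplex.exact_of_g_is_cokernel _ (C.homologyIsCokernel _ i rfl))
    obtain ⟨y, rfl⟩ := hex z hz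
    exact ⟨y, congr($(C.toCycles_i (c.prev i) i) y).symm⟩
  · rintro ⟨y, hy⟩
    have h : C.toCycles (c.prev i) i y = z := iCycles_injective i <|
      congr($(C.toCycles_i (c.prev i) i) y).trans hy
    rw [← h]
    exact congr($(C.toCycles_comp_homologyπ (c.prev i) i) y)

theorem homologyMap_homologyπ (f : C ⟶ D) {i : ι} (z : C.cycles i) :
    HomologicalComplex.homologyMap f i (C.homologyπ i z) =
      D.homologyπ i (HomologicalComplex.cyclesMap f i z) :=
  congr($(HomologicalComplex.homologyπ_naturality f i) z)

theorem iCycles_cyclesMap (f : C ⟶ D) {i : ι} (z : C.cycles i) :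
    D.iCycles i (HomologicalComplex.cyclesMap f i z) = f.f i (C.iCycles i z) :=
  congr($(HomologicalComplex.cyclesMap_i f i) z)

/-- The homology classes of a linear family of cycles. -/
def homologyClass {P : Type u} [AddCommGroup P] [Module k P] {i : ι} (f : P →ₗ[k] C.X i)
    (hf : ∀ j x, C.d i j (f x) = 0) : P →ₗ[k] C.homology i :=
  (C.liftCycles (ModuleCat.ofHom f) _ rfl (ModuleCat.hom_ext (LinearMap.ext (hf _))) ≫
    C.homologyπ i).hom

theorem exists_homologyClass_eq {P : Type u} [AddCommGroup P] [Module k P] {i : ι}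
    (f : P →ₗ[k] C.X i) (hf : ∀ j x, C.d i j (f x) = 0) (x : P) :
    ∃ z, C.iCycles i z = f x ∧ homologyClass f hf x = C.homologyπ i z :=
  ⟨_, congr($(C.liftCycles_i (ModuleCat.ofHom f) _ rfl _) x), rfl⟩

theorem rank_homology_le_rank_homology_linearYonedaObj (C : ChainComplex (ModuleCat.{u} k) ℕ)
    (n : ℕ) : Module.rank k (C.homology n) ≤
      Module.rank k ((C.linearYonedaObj k (ModuleCat.of k k)).homology n) := by
  let D := C.linearYonedaObj k (ModuleCat.of k k)
  have hι : Function.Injective (C.homologyι n) := (ModuleCat.mono_iff_injective _).1 inferInstance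
  let f : Module.Dual k (C.opcycles n) →ₗ[k] D.X n :=
    { toFun ψ := C.pOpcycles n ≫ ModuleCat.ofHom ψ
      map_add' _ _ := rfl
      map_smul' _ _ := rfl }
  have hf (j : ℕ) (ψ : Module.Dual k (C.opcycles n)) : D.d n j (f ψ) = 0 :=
    (C.d_pOpcycles_assoc j n (ModuleCat.ofHom ψ)).trans zero_comp
  calc Module.rank k (C.homology n) ≤ Module.rank k (Module.Dual k (C.homology n)) :=
        LinearMap.rank_le_of_injective _ (Module.Free.chooseBasis k _).toDual_injective
    _ ≤ Module.rank k (D.homology n) := by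
      refine rank_le_of_surjective_of_ker_le (homologyClass f hf) (C.homologyι n).hom.dualMap
        (LinearMap.dualMap_surjective_of_injective hι) fun ψ hψ => ?_
      obtain ⟨c, hc, hψc⟩ := exists_homologyClass_eq f hf ψ
      obtain ⟨y, hy⟩ := (homologyπ_eq_zero_iff rfl c).1 (hψc.symm.trans hψ)
      replace hy : C.d n _ ≫ y = C.pOpcycles n ≫ ModuleCat.ofHom ψ := hy.trans hc
      refine LinearMap.ext fun x => ?_
      obtain ⟨z, rfl⟩ := homologyπ_surjective n x
      calc ψ (C.homologyι n (C.homologyπ n z)) = ψ (C.pOpcycles n (C.iCycles n z)) :=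
            congrArg ψ congr($(C.homology_π_ι n) z)
        _ = y.hom (C.d n _ (C.iCycles n z)) := congr($hy (C.iCycles n z)).symm
        _ = 0 := by rw [d_iCycles, map_zero]

end Homology

section SingularChains

open Simplicial

variable (k : Type u) [Field k] {X Y Z : Type} [TopologicalSpace X] [TopologicalSpace Y]
  [TopologicalSpace Z]

variable (X) in
/-- The singular chain complex `C_•(X; k)`. -/
abbrev singularChains : ChainComplex (ModuleCat.{u} k) ℕ :=
  ((singularChainComplexFunctor (ModuleCat.{u} k)).obj (ModuleCat.of k k)).obj (TopCat.of X)

/-- The chain map `C_•(X; k) ⟶ C_•(Y; k)` induced by a continuous map. -/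
abbrev singularChainsMap (f : C(X, Y)) : singularChains k X ⟶ singularChains k Y :=
  ((singularChainComplexFunctor (ModuleCat.{u} k)).obj (ModuleCat.of k k)).map (TopCat.ofHom f)

theorem singularChainsMap_id : singularChainsMap k (.id X) = 𝟙 (singularChains k X) :=
  CategoryTheory.Functor.map_id _ _

theorem singularChainsMap_comp (g : C(Y, Z)) (f : C(X, Y)) :
    singularChainsMap k (g.comp f) = singularChainsMap k f ≫ singularChainsMap k g :=
  CategoryTheory.Functor.map_comp ..

variable {k} in
/-- The inclusion of the summand of `C_n(X; k)` belonging to a singular simplex, viewed as a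
continuous map on the standard simplex. -/
def singularSimplexι {n : ℕ} (σ : C(stdSimplex ℝ (Fin (n + 1)), X)) :
    ModuleCat.of k k ⟶ (singularChains k X).X n :=
  (TopCat.toSSet.obj (TopCat.of X)).ιChainComplex (((TopCat.of X).toSSetObjEquiv (.op ⦋n⦌)).symm σ)

variable (X) in
/-- The basis of `C_n(X; k)` formed by the singular simplices. -/
def singularBasis (n : ℕ) :
    Module.Basis C(stdSimplex ℝ (Fin (n + 1)), X) k ((singularChains k X).X n) :=
  (coproductBasis ((TopCat.toSSet.obj (TopCat.of X)).isColimitChainComplexXCofan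
    (ModuleCat.of k k) n)).reindex ((TopCat.of X).toSSetObjEquiv (.op ⦋n⦌))

theorem singularBasis_apply {n : ℕ} (σ : C(stdSimplex ℝ (Fin (n + 1)), X)) :
    singularBasis k X n σ = singularSimplexι σ (1 : k) :=
  ((coproductBasis ((TopCat.toSSet.obj (TopCat.of X)).isColimitChainComplexXCofan
    (ModuleCat.of k k) n)).reindex_apply ..).trans (coproductBasis_apply ..)

/-- The inclusion of the `i`-th face of the standard simplex. -/
def simplexFace {n : ℕ} (i : Fin (n + 2)) :
    C(stdSimplex ℝ (Fin (n + 1)), stdSimplex ℝ (Fin (n + 2))) :=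
  ⟨stdSimplex.map i.succAbove, stdSimplex.continuous_map _⟩

theorem d_singularBasis {n : ℕ} (σ : C(stdSimplex ℝ (Fin (n + 2)), X)) :
    (singularChains k X).d (n + 1) n (singularBasis k X (n + 1) σ) =
      ∑ i : Fin (n + 2), (-1 : ℤ) ^ (i : ℕ) • singularBasis k X n (σ.comp (simplexFace i)) := by
  have h : singularSimplexι σ ≫ (singularChains k X).d (n + 1) n =
      ∑ i : Fin (n + 2), (-1 : ℤ) ^ (i : ℕ) • singularSimplexι (σ.comp (simplexFace i)) :=
    (TopCat.toSSet.obj (TopCat.of X)).ιChainComplex_d (ModuleCat.of k k) _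
  simp only [singularBasis_apply]
  refine congr(ModuleCat.Hom.hom $h (1 : k)).trans ?_
  rw [ModuleCat.hom_sum, LinearMap.sum_apply]
  rfl

theorem singularChainsMap_singularBasis (f : C(X, Y)) {n : ℕ}
    (σ : C(stdSimplex ℝ (Fin (n + 1)), X)) :
    (singularChainsMap k f).f n (singularBasis k X n σ) = singularBasis k Y n (f.comp σ) := by
  simp only [singularBasis_apply]
  exact congr($(SSet.ι_chainComplexMap_f (TopCat.toSSet.obj (TopCat.of X))
    (TopCat.toSSet.obj (TopCat.of Y)) (TopCat.toSSet.map (TopCat.ofHom f)) (ModuleCat.of k k)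
    (((TopCat.of X).toSSetObjEquiv (.op ⦋n⦌)).symm σ)) (1 : k))

/-- The map `H_n(X; k) → H_n(Y; k)` induced by a continuous map. -/
abbrev singularHomologyMap (f : C(X, Y)) (n : ℕ) :
    (singularChains k X).homology n →ₗ[k] (singularChains k Y).homology n :=
  (HomologicalComplex.homologyMap (singularChainsMap k f) n).hom

theorem singularHomologyMap_comp (g : C(Y, Z)) (f : C(X, Y)) (n : ℕ) :
    singularHomologyMap k (g.comp f) n = singularHomologyMap k g n ∘ₗ singularHomologyMap k f n :=
  congrArg ModuleCat.Hom.hom <| (congrArg (HomologicalComplex.homologyMap · n)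
    (singularChainsMap_comp k g f)).trans (HomologicalComplex.homologyMap_comp ..)

theorem singularHomologyMap_comp_apply (g : C(Y, Z)) (f : C(X, Y)) (n : ℕ)
    (x : (singularChains k X).homology n) :
    singularHomologyMap k (g.comp f) n x =
      singularHomologyMap k g n (singularHomologyMap k f n x) :=
  LinearMap.congr_fun (singularHomologyMap_comp k g f n) x

theorem singularHomologyMap_id (n : ℕ) : singularHomologyMap k (.id X) n = .id :=
  congrArg ModuleCat.Hom.hom <| (congrArg (HomologicalComplex.homologyMap · n)
    (singularChainsMap_id k)).trans (HomologicalComplex.homologyMap_id ..)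

variable {k} in
theorem singularHomologyMap_eq_of_homotopic {f g : C(X, Y)} (h : f.Homotopic g) (n : ℕ) :
    singularHomologyMap k f n = singularHomologyMap k g n :=
  congrArg ModuleCat.Hom.hom (TopCat.Homotopy.congr_homologyMap_singularChainComplexFunctor
    (f := TopCat.ofHom f) (g := TopCat.ofHom g) h.some (ModuleCat.of k k) n)

theorem singularHomologyMap_bijective (e : X ≃ₕ Y) (n : ℕ) :
    Function.Bijective (singularHomologyMap k e.toFun n) := by
  have h₁ := singularHomologyMap_eq_of_homotopic (k := k) e.left_inv n
  have h₂ := singularHomologyMap_eq_of_homotopic (k := k) e.right_inv n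
  rw [singularHomologyMap_comp, singularHomologyMap_id] at h₁ h₂
  exact ⟨Function.LeftInverse.injective (LinearMap.congr_fun h₁),
    Function.RightInverse.surjective (LinearMap.congr_fun h₂)⟩

variable (X) in
/-- The total dimension `∑ₙ dim_k H_n(X; k)`, as a cardinal number. -/
def totalHomologyDim : Cardinal.{u} :=
  Cardinal.sum fun n => Module.rank k ((singularChains k X).homology n)

variable (X) in
theorem totalHomologyDim_le_totalCohomologyDim :
    totalHomologyDim k X ≤ totalCohomologyDim k X :=
  Cardinal.sum_le_sum _ _ (rank_homology_le_rank_homology_linearYonedaObj (singularChains k X))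

theorem rank_homology_le_of_leftInverse {f : C(X, Y)} {g : C(Y, X)}
    (h : Function.LeftInverse g f) (n : ℕ) :
    Module.rank k ((singularChains k X).homology n) ≤
      Module.rank k ((singularChains k Y).homology n) := by
  have hgf : g.comp f = .id X := ContinuousMap.ext h
  refine LinearMap.rank_le_of_surjective (singularHomologyMap k g n) <|
    Function.RightInverse.surjective (g := singularHomologyMap k f n) fun x => ?_
  rw [← singularHomologyMap_comp_apply, hgf, singularHomologyMap_id,
    LinearMap.id_apply]

theorem totalHomologyDim_le_of_leftInverse {f : C(X, Y)} {g : C(Y, X)}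
    (h : Function.LeftInverse g f) : totalHomologyDim k X ≤ totalHomologyDim k Y :=
  Cardinal.sum_le_sum _ _ (rank_homology_le_of_leftInverse k h)

theorem mk_le_totalHomologyDim [TotallyDisconnectedSpace X] :
    Cardinal.lift.{u} (Cardinal.mk X) ≤ totalHomologyDim k X := by
  let e := (singularHomologyFunctorZeroOfTotallyDisconnectedSpace (ModuleCat.{u} k)
    (ModuleCat.of k k) (TopCat.of X)).toLinearEquiv
  calc Cardinal.lift.{u} (Cardinal.mk X)
      = Module.rank k (∐ fun _ : X => ModuleCat.of k k : ModuleCat.{u} k) := by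
        simpa using!
          (coproductBasis (coproductIsCoproduct fun _ : X => ModuleCat.of k k)).mk_eq_rank
    _ = Module.rank k ((singularChains k X).homology 0) := e.rank_eq.symm
    _ ≤ totalHomologyDim k X := Cardinal.le_sum _ 0

end SingularChains

section TupleChains

variable (k : Type u) [Field k] {S S' : Type*}

/-- Formal linear combinations of `n`-tuples of elements of `S`: the augmented chain complex of the
full simplex with vertex set `S`, indexed so that an `n`-tuple has degree `n`. -/
abbrev TupleChain (S : Type*) (n : ℕ) : Type _ := (Fin n → S) →₀ k

variable {k} in
theorem TupleChain.linearMap_apply_eq {n : ℕ} {M : Type*} [AddCommGroup M] [Module k M]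
    {f g : TupleChain k S n →ₗ[k] M} (h : ∀ v, f (.single v 1) = g (.single v 1))
    (c : TupleChain k S n) : f c = g c :=
  LinearMap.congr_fun (Finsupp.basisSingleOne.ext h) c

/-- The alternating sum of the faces of a tuple. -/
def tupleBoundary (n : ℕ) : TupleChain k S (n + 1) →ₗ[k] TupleChain k S n :=
  Finsupp.linearCombination k fun v =>
    ∑ i : Fin (n + 1), (-1 : ℤ) ^ (i : ℕ) • Finsupp.single (i.removeNth v) 1

/-- The cone with apex `b`. -/
def tupleCone (b : S) (n : ℕ) : TupleChain k S n →ₗ[k] TupleChain k S (n + 1) :=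
  Finsupp.lmapDomain k k fun v : Fin n → S => (Fin.cons b v : Fin (n + 1) → S)

/-- The map of tuple chains induced by a map of vertices. -/
def tupleMap (f : S → S') (n : ℕ) : TupleChain k S n →ₗ[k] TupleChain k S' n :=
  Finsupp.lmapDomain k k (f ∘ ·)

theorem tupleBoundary_single {n : ℕ} (v : Fin (n + 1) → S) :
    tupleBoundary k n (.single v 1) =
      ∑ i : Fin (n + 1), (-1 : ℤ) ^ (i : ℕ) • Finsupp.single (i.removeNth v) 1 := by
  rw [tupleBoundary, Finsupp.linearCombination_single, one_smul]

theorem tupleCone_single (b : S) {n : ℕ} (v : Fin n → S) :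
    tupleCone k b n (.single v 1) = .single (Fin.cons b v) 1 := by
  rw [tupleCone, Finsupp.lmapDomain_apply, Finsupp.mapDomain_single]

theorem tupleMap_single (f : S → S') {n : ℕ} (v : Fin n → S) :
    tupleMap k f n (.single v 1) = .single (f ∘ v) 1 := by
  rw [tupleMap, Finsupp.lmapDomain_apply, Finsupp.mapDomain_single]

variable {k}

theorem tupleBoundary_tupleCone_zero (b : S) (c : TupleChain k S 0) :
    tupleBoundary k 0 (tupleCone k b 0 c) = c := by
  refine TupleChain.linearMap_apply_eq (f := tupleBoundary k 0 ∘ₗ tupleCone k b 0) (g := .id)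
    (fun v => ?_) c
  simp [tupleCone_single, tupleBoundary_single, Subsingleton.elim _ v]

theorem tupleBoundary_tupleCone (b : S) {n : ℕ} (c : TupleChain k S (n + 1)) :
    tupleBoundary k (n + 1) (tupleCone k b (n + 1) c) =
      c - tupleCone k b n (tupleBoundary k n c) := by
  refine TupleChain.linearMap_apply_eq (f := tupleBoundary k (n + 1) ∘ₗ tupleCone k b (n + 1))
    (g := .id - tupleCone k b n ∘ₗ tupleBoundary k n) (fun v => ?_) c
  have h (i : Fin (n + 1)) : i.succ.removeNth (Fin.cons b v : Fin (n + 2) → S) =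
      Fin.cons b (i.removeNth v) := by
    refine funext fun j => Fin.cases ?_ (fun j => ?_) j <;> simp [Fin.removeNth]
  simp only [LinearMap.comp_apply, LinearMap.sub_apply, LinearMap.id_apply, tupleCone_single,
    tupleBoundary_single, Fin.sum_univ_succ (n := n + 1), h, map_sum, map_zsmul, Fin.val_succ,
    pow_succ, mul_neg_one, neg_smul, Finset.sum_neg_distrib, sub_eq_add_neg]
  simp

theorem tupleBoundary_tupleBoundary {n : ℕ} (c : TupleChain k S (n + 2)) :
    tupleBoundary k n (tupleBoundary k (n + 1) c) = 0 := by
  refine TupleChain.linearMap_apply_eq (f := tupleBoundary k n ∘ₗ tupleBoundary k (n + 1)) (g := 0)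
    (fun v => ?_) c
  rw [LinearMap.comp_apply, ← Fin.cons_self_tail v, ← tupleCone_single, tupleBoundary_tupleCone,
    map_sub, LinearMap.zero_apply, sub_eq_zero]
  cases n with
  | zero => rw [tupleBoundary_tupleCone_zero]
  | succ n => rw [tupleBoundary_tupleCone, tupleBoundary_tupleBoundary, map_zero, sub_zero]

theorem tupleMap_tupleBoundary (f : S → S') {n : ℕ} (c : TupleChain k S (n + 1)) :
    tupleMap k f n (tupleBoundary k n c) = tupleBoundary k n (tupleMap k f (n + 1) c) := by
  refine TupleChain.linearMap_apply_eq (f := tupleMap k f n ∘ₗ tupleBoundary k n)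
    (g := tupleBoundary k n ∘ₗ tupleMap k f (n + 1)) (fun v => ?_) c
  simp only [LinearMap.comp_apply, tupleBoundary_single, tupleMap_single, map_sum, map_zsmul]
  rfl

theorem tupleMap_tupleCone (f : S → S') (b : S) {n : ℕ} (c : TupleChain k S n) :
    tupleMap k f (n + 1) (tupleCone k b n c) = tupleCone k (f b) n (tupleMap k f n c) := by
  refine TupleChain.linearMap_apply_eq (f := tupleMap k f (n + 1) ∘ₗ tupleCone k b n)
    (g := tupleCone k (f b) n ∘ₗ tupleMap k f n) (fun v => ?_) c
  simp only [LinearMap.comp_apply, tupleMap_single, tupleCone_single, Fin.comp_cons]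

end TupleChains

section TupleSubdivision

variable (k : Type u) [Field k] {S S' : Type*} (β : ∀ ⦃n : ℕ⦄, (Fin (n + 1) → S) → S)

/-- Barycentric subdivision of tuple chains, with `β v` in the role of the barycenter of `v`: a
tuple is sent to the cone with apex `β v` over its subdivided boundary. -/
def tupleSd : ∀ n, TupleChain k S n →ₗ[k] TupleChain k S n
  | 0 => .id
  | n + 1 => Finsupp.linearCombination k fun v =>
      tupleCone k (β v) n (tupleSd n (tupleBoundary k n (.single v 1)))

/-- The chain homotopy between barycentric subdivision and the identity. -/
def tupleSdHomotopy : ∀ n, TupleChain k S n →ₗ[k] TupleChain k S (n + 1)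
  | 0 => 0
  | n + 1 => Finsupp.linearCombination k fun v => tupleCone k (β v) (n + 1)
      (.single v 1 - tupleSdHomotopy n (tupleBoundary k n (.single v 1)))

theorem tupleSd_succ_single {n : ℕ} (v : Fin (n + 1) → S) : tupleSd k β (n + 1) (.single v 1) =
    tupleCone k (β v) n (tupleSd k β n (tupleBoundary k n (.single v 1))) := by
  rw [tupleSd, Finsupp.linearCombination_single, one_smul]

theorem tupleSdHomotopy_succ_single {n : ℕ} (v : Fin (n + 1) → S) :
    tupleSdHomotopy k β (n + 1) (.single v 1) = tupleCone k (β v) (n + 1)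
      (.single v 1 - tupleSdHomotopy k β n (tupleBoundary k n (.single v 1))) := by
  rw [tupleSdHomotopy, Finsupp.linearCombination_single, one_smul]

variable {k}

theorem tupleBoundary_tupleSd {n : ℕ} (c : TupleChain k S (n + 1)) :
    tupleBoundary k n (tupleSd k β (n + 1) c) = tupleSd k β n (tupleBoundary k n c) := by
  refine TupleChain.linearMap_apply_eq (f := tupleBoundary k n ∘ₗ tupleSd k β (n + 1))
    (g := tupleSd k β n ∘ₗ tupleBoundary k n) (fun v => ?_) c
  rw [LinearMap.comp_apply, LinearMap.comp_apply, tupleSd_succ_single]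
  cases n with
  | zero => rw [tupleBoundary_tupleCone_zero]
  | succ n => rw [tupleBoundary_tupleCone, tupleBoundary_tupleSd, tupleBoundary_tupleBoundary,
      map_zero, map_zero, sub_zero]

theorem tupleBoundary_tupleSdHomotopy {n : ℕ} (c : TupleChain k S (n + 1)) :
    tupleBoundary k (n + 1) (tupleSdHomotopy k β (n + 1) c) =
      c - tupleSd k β (n + 1) c - tupleSdHomotopy k β n (tupleBoundary k n c) := by
  refine TupleChain.linearMap_apply_eq
    (f := tupleBoundary k (n + 1) ∘ₗ tupleSdHomotopy k β (n + 1))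
    (g := .id - tupleSd k β (n + 1) - tupleSdHomotopy k β n ∘ₗ tupleBoundary k n) (fun v => ?_) c
  simp only [LinearMap.comp_apply, LinearMap.sub_apply, LinearMap.id_apply]
  rw [tupleSdHomotopy_succ_single, tupleBoundary_tupleCone, tupleSd_succ_single, map_sub]
  cases n with
  | zero => simp [tupleSd, tupleSdHomotopy]
  | succ n =>
    rw [tupleBoundary_tupleSdHomotopy, tupleBoundary_tupleBoundary]
    simp [sub_right_comm]

variable {β} {β' : ∀ ⦃n : ℕ⦄, (Fin (n + 1) → S') → S'} {f : S → S'}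

theorem tupleMap_tupleSd (hf : ∀ ⦃n⦄ (v : Fin (n + 1) → S), f (β v) = β' (f ∘ v)) {n : ℕ}
    (c : TupleChain k S n) :
    tupleMap k f n (tupleSd k β n c) = tupleSd k β' n (tupleMap k f n c) := by
  refine TupleChain.linearMap_apply_eq (f := tupleMap k f n ∘ₗ tupleSd k β n)
    (g := tupleSd k β' n ∘ₗ tupleMap k f n) (fun v => ?_) c
  rw [LinearMap.comp_apply, LinearMap.comp_apply, tupleMap_single]
  cases n with
  | zero => rw [tupleSd, tupleSd, LinearMap.id_apply, LinearMap.id_apply, tupleMap_single]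
  | succ n => rw [tupleSd_succ_single, tupleSd_succ_single, tupleMap_tupleCone, hf,
      tupleMap_tupleSd hf, tupleMap_tupleBoundary, tupleMap_single]

theorem tupleMap_tupleSdHomotopy (hf : ∀ ⦃n⦄ (v : Fin (n + 1) → S), f (β v) = β' (f ∘ v)) {n : ℕ}
    (c : TupleChain k S n) : tupleMap k f (n + 1) (tupleSdHomotopy k β n c) =
      tupleSdHomotopy k β' n (tupleMap k f n c) := by
  refine TupleChain.linearMap_apply_eq (f := tupleMap k f (n + 1) ∘ₗ tupleSdHomotopy k β n)
    (g := tupleSdHomotopy k β' n ∘ₗ tupleMap k f n) (fun v => ?_) c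
  rw [LinearMap.comp_apply, LinearMap.comp_apply, tupleMap_single]
  cases n with
  | zero => simp [tupleSdHomotopy]
  | succ n => rw [tupleSdHomotopy_succ_single, tupleSdHomotopy_succ_single, tupleMap_tupleCone, hf,
      map_sub, tupleMap_tupleSdHomotopy hf, tupleMap_tupleBoundary, tupleMap_single]

end TupleSubdivision

section AffineSimplex

variable {ι κ κ' : Type*} [Fintype ι] [Fintype κ'] [Fintype κ]

/-- The affine map of standard simplices with prescribed values at the vertices. -/
def affineSimplex (v : ι → stdSimplex ℝ κ) : C(stdSimplex ℝ ι, stdSimplex ℝ κ) where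
  toFun t := ⟨∑ i, t i • (v i : κ → ℝ),
    (convex_stdSimplex ℝ κ).sum_mem (fun i _ => t.2.1 i) t.2.2 fun i _ => (v i).2⟩
  continuous_toFun := by
    refine .subtype_mk (continuous_finsetSum _ fun i _ => ?_) _
    exact ((continuous_apply i).comp continuous_subtype_val).smul continuous_const

theorem coe_affineSimplex (v : ι → stdSimplex ℝ κ) (t : stdSimplex ℝ ι) :
    (affineSimplex v t : κ → ℝ) = ∑ i, t i • (v i : κ → ℝ) := rfl

theorem affineSimplex_comp (v : κ → stdSimplex ℝ κ') (w : ι → stdSimplex ℝ κ) :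
    (affineSimplex v).comp (affineSimplex w) = affineSimplex (affineSimplex v ∘ w) := by
  ext t j
  have h (i : κ) : (affineSimplex w t) i = ∑ l, t l * w l i :=
    (congrFun (coe_affineSimplex w t) i).trans (Finset.sum_apply ..)
  change (affineSimplex v (affineSimplex w t) : κ' → ℝ) j =
    (affineSimplex (affineSimplex v ∘ w) t : κ' → ℝ) j
  simp only [coe_affineSimplex, h, Function.comp_apply, Finset.smul_sum, Finset.sum_smul, smul_smul]
  rw [Finset.sum_comm]

theorem affineSimplex_vertex [DecidableEq ι] :
    affineSimplex (fun i : ι => stdSimplex.vertex (S := ℝ) i) = .id _ := by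
  ext t j
  change (affineSimplex _ t : ι → ℝ) j = t j
  simp [coe_affineSimplex, Pi.single_apply]

theorem affineSimplex_comp_simplexFace {n : ℕ} (v : Fin (n + 2) → stdSimplex ℝ κ)
    (i : Fin (n + 2)) :
    (affineSimplex v).comp (simplexFace i) = affineSimplex (i.removeNth v) := by
  ext t : 2
  simp only [ContinuousMap.comp_apply, coe_affineSimplex, simplexFace, ContinuousMap.coe_mk,
    Fin.removeNth, stdSimplex.map_coe, FunOnFinite.linearMap_apply_apply, Finset.sum_smul]
  rw [← Finset.sum_fiberwise Finset.univ i.succAbove]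
  refine Finset.sum_congr rfl fun j _ => Finset.sum_congr rfl fun l hl => ?_
  rw [(Finset.mem_filter.1 hl).2]

/-- The barycenter of a tuple of points of a standard simplex. -/
def tupleBarycenter ⦃n : ℕ⦄ (v : Fin (n + 1) → stdSimplex ℝ κ) : stdSimplex ℝ κ :=
  affineSimplex v stdSimplex.barycenter

theorem affineSimplex_tupleBarycenter (v : ι → stdSimplex ℝ κ) ⦃n : ℕ⦄
    (w : Fin (n + 1) → stdSimplex ℝ ι) :
    affineSimplex v (tupleBarycenter w) = tupleBarycenter (affineSimplex v ∘ w) :=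
  congr($(affineSimplex_comp v w) stdSimplex.barycenter)

end AffineSimplex

section SingularSubdivision

variable (k : Type u) [Field k] {X Y : Type} [TopologicalSpace X] [TopologicalSpace Y]
  {κ κ' : Type*} [Fintype κ'] [Fintype κ]

/-- The singular chain in `X` obtained from a combination of tuples of points of a standard simplex
by composing the affine simplices they span with `σ`. -/
def affineChain (σ : C(stdSimplex ℝ κ, X)) (n : ℕ) :
    TupleChain k (stdSimplex ℝ κ) (n + 1) →ₗ[k] (singularChains k X).X n :=
  Finsupp.linearCombination k fun v => singularBasis k X n (σ.comp (affineSimplex v))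

theorem affineChain_single (σ : C(stdSimplex ℝ κ, X)) {n : ℕ} (v : Fin (n + 1) → stdSimplex ℝ κ) :
    affineChain k σ n (.single v 1) = singularBasis k X n (σ.comp (affineSimplex v)) := by
  rw [affineChain, Finsupp.linearCombination_single, one_smul]

/-- The tuple of all vertices of the standard `n`-simplex, as a tuple chain. -/
def fundamentalTuple (n : ℕ) : TupleChain k (stdSimplex ℝ (Fin (n + 1))) (n + 1) :=
  .single stdSimplex.vertex 1

theorem affineChain_fundamentalTuple {n : ℕ} (σ : C(stdSimplex ℝ (Fin (n + 1)), X)) :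
    affineChain k σ n (fundamentalTuple k n) = singularBasis k X n σ := by
  rw [fundamentalTuple, affineChain_single, affineSimplex_vertex, ContinuousMap.comp_id]

theorem tupleMap_affineSimplex_fundamentalTuple {n : ℕ} (v : Fin (n + 1) → stdSimplex ℝ κ) :
    tupleMap k (affineSimplex v) (n + 1) (fundamentalTuple k n) = .single v 1 := by
  have h : affineSimplex v ∘ stdSimplex.vertex = v := by
    refine funext fun i => stdSimplex.ext ?_
    simp [coe_affineSimplex, Pi.single_apply]
  rw [fundamentalTuple, tupleMap_single, h]

variable {k}

theorem affineChain_comp (σ : C(stdSimplex ℝ κ, X)) (v : κ' → stdSimplex ℝ κ) {n : ℕ}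
    (c : TupleChain k (stdSimplex ℝ κ') (n + 1)) :
    affineChain k (σ.comp (affineSimplex v)) n c =
      affineChain k σ n (tupleMap k (affineSimplex v) (n + 1) c) := by
  refine TupleChain.linearMap_apply_eq
    (g := affineChain k σ n ∘ₗ tupleMap k (affineSimplex v) (n + 1)) (fun w => ?_) c
  rw [LinearMap.comp_apply, tupleMap_single, affineChain_single, affineChain_single,
    ContinuousMap.comp_assoc, affineSimplex_comp]

theorem singularChainsMap_affineChain (f : C(X, Y)) (σ : C(stdSimplex ℝ κ, X)) {n : ℕ}
    (c : TupleChain k (stdSimplex ℝ κ) (n + 1)) :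
    (singularChainsMap k f).f n (affineChain k σ n c) = affineChain k (f.comp σ) n c := by
  refine TupleChain.linearMap_apply_eq
    (f := ((singularChainsMap k f).f n).hom ∘ₗ affineChain k σ n) (fun w => ?_) c
  rw [LinearMap.comp_apply, affineChain_single, affineChain_single]
  exact singularChainsMap_singularBasis ..

theorem d_affineChain (σ : C(stdSimplex ℝ κ, X)) {n : ℕ}
    (c : TupleChain k (stdSimplex ℝ κ) (n + 2)) :
    (singularChains k X).d (n + 1) n (affineChain k σ (n + 1) c) =
      affineChain k σ n (tupleBoundary k (n + 1) c) := by
  refine TupleChain.linearMap_apply_eq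
    (f := ((singularChains k X).d (n + 1) n).hom ∘ₗ affineChain k σ (n + 1))
    (g := affineChain k σ n ∘ₗ tupleBoundary k (n + 1)) (fun w => ?_) c
  rw [LinearMap.comp_apply, LinearMap.comp_apply, affineChain_single, tupleBoundary_single]
  refine (d_singularBasis ..).trans ?_
  simp only [map_sum, map_zsmul, affineChain_single, ContinuousMap.comp_assoc,
    affineSimplex_comp_simplexFace]

variable (k X) in
/-- The barycentric subdivision of singular chains. -/
def singularSd (n : ℕ) : (singularChains k X).X n →ₗ[k] (singularChains k X).X n :=
  (singularBasis k X n).constr k fun σ =>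
    affineChain k σ n (tupleSd k tupleBarycenter (n + 1) (fundamentalTuple k n))

variable (k X) in
/-- The chain homotopy between barycentric subdivision of singular chains and the identity. -/
def singularSdHomotopy (n : ℕ) : (singularChains k X).X n →ₗ[k] (singularChains k X).X (n + 1) :=
  (singularBasis k X n).constr k fun σ =>
    affineChain k σ (n + 1) (tupleSdHomotopy k tupleBarycenter (n + 1) (fundamentalTuple k n))

theorem singularSd_affineChain (σ : C(stdSimplex ℝ κ, X)) {n : ℕ}
    (c : TupleChain k (stdSimplex ℝ κ) (n + 1)) :
    singularSd k X n (affineChain k σ n c) =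
      affineChain k σ n (tupleSd k tupleBarycenter (n + 1) c) := by
  refine TupleChain.linearMap_apply_eq (f := singularSd k X n ∘ₗ affineChain k σ n)
    (g := affineChain k σ n ∘ₗ tupleSd k tupleBarycenter (n + 1)) (fun v => ?_) c
  rw [LinearMap.comp_apply, LinearMap.comp_apply, affineChain_single, singularSd,
    Module.Basis.constr_basis, affineChain_comp, tupleMap_tupleSd (affineSimplex_tupleBarycenter v),
    tupleMap_affineSimplex_fundamentalTuple]

theorem singularSdHomotopy_affineChain (σ : C(stdSimplex ℝ κ, X)) {n : ℕ}
    (c : TupleChain k (stdSimplex ℝ κ) (n + 1)) :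
    singularSdHomotopy k X n (affineChain k σ n c) =
      affineChain k σ (n + 1) (tupleSdHomotopy k tupleBarycenter (n + 1) c) := by
  refine TupleChain.linearMap_apply_eq (f := singularSdHomotopy k X n ∘ₗ affineChain k σ n)
    (g := affineChain k σ (n + 1) ∘ₗ tupleSdHomotopy k tupleBarycenter (n + 1)) (fun v => ?_) c
  rw [LinearMap.comp_apply, LinearMap.comp_apply, affineChain_single, singularSdHomotopy,
    Module.Basis.constr_basis, affineChain_comp,
    tupleMap_tupleSdHomotopy (affineSimplex_tupleBarycenter v),
    tupleMap_affineSimplex_fundamentalTuple]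

theorem d_singularSd {n : ℕ} (x : (singularChains k X).X (n + 1)) :
    (singularChains k X).d (n + 1) n (singularSd k X (n + 1) x) =
      singularSd k X n ((singularChains k X).d (n + 1) n x) := by
  refine LinearMap.congr_fun (f := ((singularChains k X).d (n + 1) n).hom ∘ₗ singularSd k X (n + 1))
    (g := singularSd k X n ∘ₗ ((singularChains k X).d (n + 1) n).hom)
    ((singularBasis k X (n + 1)).ext fun σ => ?_) x
  rw [LinearMap.comp_apply, LinearMap.comp_apply, ← affineChain_fundamentalTuple,
    singularSd_affineChain]
  simp only [d_affineChain, singularSd_affineChain, tupleBoundary_tupleSd]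

theorem d_singularSd_of_cycle {n : ℕ} {x : (singularChains k X).X n}
    (hx : ∀ j, (singularChains k X).d n j x = 0) (j : ℕ) :
    (singularChains k X).d n j (singularSd k X n x) = 0 := by
  by_cases hj : j + 1 = n
  · subst hj
    rw [d_singularSd, hx, map_zero]
  · rw [(singularChains k X).shape n j hj]
    rfl

theorem d_singularSdHomotopy_affineChain (σ : C(stdSimplex ℝ κ, X)) {n : ℕ}
    (c : TupleChain k (stdSimplex ℝ κ) (n + 1)) :
    (singularChains k X).d (n + 1) n (singularSdHomotopy k X n (affineChain k σ n c)) =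
      affineChain k σ n c - singularSd k X n (affineChain k σ n c) -
        affineChain k σ n (tupleSdHomotopy k tupleBarycenter n (tupleBoundary k n c)) := by
  rw [singularSdHomotopy_affineChain, d_affineChain, tupleBoundary_tupleSdHomotopy, map_sub,
    map_sub, singularSd_affineChain]

theorem d_singularSdHomotopy_zero (x : (singularChains k X).X 0) :
    (singularChains k X).d 1 0 (singularSdHomotopy k X 0 x) = x - singularSd k X 0 x := by
  refine LinearMap.congr_fun (f := ((singularChains k X).d 1 0).hom ∘ₗ singularSdHomotopy k X 0)
    (g := .id - singularSd k X 0) ((singularBasis k X 0).ext fun σ => ?_) x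
  rw [LinearMap.comp_apply, ← affineChain_fundamentalTuple]
  refine (d_singularSdHomotopy_affineChain ..).trans ?_
  rw [tupleSdHomotopy, LinearMap.zero_apply, map_zero, sub_zero]
  rfl

theorem d_singularSdHomotopy_succ {n : ℕ} (x : (singularChains k X).X (n + 1)) :
    (singularChains k X).d (n + 2) (n + 1) (singularSdHomotopy k X (n + 1) x) =
      x - singularSd k X (n + 1) x -
        singularSdHomotopy k X n ((singularChains k X).d (n + 1) n x) := by
  refine LinearMap.congr_fun
    (f := ((singularChains k X).d (n + 2) (n + 1)).hom ∘ₗ singularSdHomotopy k X (n + 1))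
    (g := .id - singularSd k X (n + 1) -
      singularSdHomotopy k X n ∘ₗ ((singularChains k X).d (n + 1) n).hom)
    ((singularBasis k X (n + 1)).ext fun σ => ?_) x
  rw [LinearMap.comp_apply, ← affineChain_fundamentalTuple]
  refine (d_singularSdHomotopy_affineChain ..).trans ?_
  rw [← singularSdHomotopy_affineChain, ← d_affineChain]
  rfl

theorem d_singularSdHomotopy_of_cycle {n : ℕ} {x : (singularChains k X).X n}
    (hx : ∀ j, (singularChains k X).d n j x = 0) :
    (singularChains k X).d (n + 1) n (singularSdHomotopy k X n x) = x - singularSd k X n x := by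
  cases n with
  | zero => exact d_singularSdHomotopy_zero x
  | succ n => rw [d_singularSdHomotopy_succ, hx, map_zero, sub_zero]

theorem exists_d_eq_sub_singularSd_pow {n : ℕ} {x : (singularChains k X).X n}
    (hx : ∀ j, (singularChains k X).d n j x = 0) (N : ℕ) :
    ∃ y, (singularChains k X).d (n + 1) n y = x - (singularSd k X n ^ N) x := by
  induction N generalizing x with
  | zero => exact ⟨0, by simp⟩
  | succ N ih =>
    obtain ⟨y, hy⟩ := ih (d_singularSd_of_cycle hx)
    refine ⟨singularSdHomotopy k X n x + y, ?_⟩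
    rw [map_add, d_singularSdHomotopy_of_cycle hx, hy, pow_succ, Module.End.mul_apply,
      sub_add_sub_cancel]

theorem d_singularSd_pow {n : ℕ} (N : ℕ) (x : (singularChains k X).X (n + 1)) :
    (singularChains k X).d (n + 1) n ((singularSd k X (n + 1) ^ N) x) =
      (singularSd k X n ^ N) ((singularChains k X).d (n + 1) n x) :=
  (LinearMap.congr_fun (Module.End.commute_pow_left_of_commute
    (f := ((singularChains k X).d (n + 1) n).hom)
    (LinearMap.ext fun x => (d_singularSd x).symm) N) x).symm

theorem singularChainsMap_singularSd (f : C(X, Y)) {n : ℕ} (x : (singularChains k X).X n) :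
    (singularChainsMap k f).f n (singularSd k X n x) =
      singularSd k Y n ((singularChainsMap k f).f n x) := by
  refine LinearMap.congr_fun (f := ((singularChainsMap k f).f n).hom ∘ₗ singularSd k X n)
    (g := singularSd k Y n ∘ₗ ((singularChainsMap k f).f n).hom)
    ((singularBasis k X n).ext fun σ => ?_) x
  rw [LinearMap.comp_apply, LinearMap.comp_apply, ← affineChain_fundamentalTuple,
    singularSd_affineChain]
  simp only [singularChainsMap_affineChain, singularSd_affineChain]

theorem singularChainsMap_singularSd_pow (f : C(X, Y)) {n : ℕ} (N : ℕ)
    (x : (singularChains k X).X n) :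
    (singularChainsMap k f).f n ((singularSd k X n ^ N) x) =
      (singularSd k Y n ^ N) ((singularChainsMap k f).f n x) :=
  (LinearMap.congr_fun (Module.End.commute_pow_left_of_commute
    (f := ((singularChainsMap k f).f n).hom)
    (LinearMap.ext fun x => (singularChainsMap_singularSd f x).symm) N) x).symm

end SingularSubdivision

section Mesh

variable {k : Type u} [Field k]

theorem map_mem_of_mem_supported {α M : Type*} [AddCommGroup M] [Module k M]
    {f : (α →₀ k) →ₗ[k] M} {s : Set α} {p : Submodule k M} (h : ∀ a ∈ s, f (.single a 1) ∈ p)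
    {c : α →₀ k} (hc : c ∈ Finsupp.supported k k s) : f c ∈ p := by
  rw [Finsupp.supported_eq_span_single] at hc
  exact (Submodule.span_le (p := p.comap f)).2 (Set.forall_mem_image.2 h) hc

/-- `IsSubdivisionSimplex β v u` says that `u` is one of the simplices of the barycentric
subdivision of the simplex `v`, with `β` in the role of the barycenter. -/
inductive IsSubdivisionSimplex {S : Type*} (β : ∀ ⦃n : ℕ⦄, (Fin (n + 1) → S) → S) :
    ∀ {n : ℕ}, (Fin n → S) → (Fin n → S) → Prop
  | nil (v : Fin 0 → S) : IsSubdivisionSimplex β v v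
  | cons {n : ℕ} {v : Fin (n + 1) → S} {i : Fin (n + 1)} {u : Fin n → S}
      (h : IsSubdivisionSimplex β (i.removeNth v) u) : IsSubdivisionSimplex β v (Fin.cons (β v) u)

theorem tupleSd_single_mem_supported {S : Type*} (β : ∀ ⦃n : ℕ⦄, (Fin (n + 1) → S) → S) {n : ℕ}
    (v : Fin n → S) :
    tupleSd k β n (.single v 1) ∈ Finsupp.supported k k {u | IsSubdivisionSimplex β v u} := by
  induction n with
  | zero => exact Finsupp.single_mem_supported k _ (.nil v)
  | succ n ih =>
    rw [tupleSd_succ_single, tupleBoundary_single, map_sum, map_sum]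
    refine Submodule.sum_mem _ fun i _ => ?_
    rw [map_zsmul, map_zsmul]
    refine zsmul_mem (map_mem_of_mem_supported (fun u hu => ?_) (ih (i.removeNth v))) _
    rw [tupleCone_single]
    exact Finsupp.single_mem_supported k _ (.cons hu)

variable {ι κ : Type*} [Fintype ι] [Fintype κ]

theorem dist_affineSimplex_le (v : ι → stdSimplex ℝ κ) (t : stdSimplex ℝ ι) {q : stdSimplex ℝ κ}
    {e : ℝ} (h : ∀ i, dist (v i) q ≤ e) : dist (affineSimplex v t) q ≤ e :=
  (convex_closedBall (q : κ → ℝ) e).sum_mem (z := fun i => (v i : κ → ℝ)) (fun i _ => t.2.1 i)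
    t.2.2 fun i _ => h i

theorem dist_tupleBarycenter_le {n : ℕ} (v : Fin (n + 1) → stdSimplex ℝ κ) {d : ℝ}
    (h : ∀ i j, dist (v i) (v j) ≤ d) (i : Fin (n + 1)) :
    dist (v i) (tupleBarycenter v) ≤ (1 - (↑(n + 1) : ℝ)⁻¹) * d := by
  have hb (j : Fin (n + 1)) :
      (stdSimplex.barycenter : stdSimplex ℝ (Fin (n + 1))) j = (↑(n + 1) : ℝ)⁻¹ := by
    exact (stdSimplex.barycenter_apply (𝕜 := ℝ) j).trans (by rw [Fintype.card_fin])
  have hsum : (v i).1 - (tupleBarycenter v).1 =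
      ∑ j, (↑(n + 1) : ℝ)⁻¹ • ((v i).1 - (v j).1) := by
    change (v i).1 - (tupleBarycenter v : κ → ℝ) = _
    simp only [tupleBarycenter, coe_affineSimplex, hb, smul_sub, Finset.sum_sub_distrib,
      Finset.sum_const, Finset.card_univ, Fintype.card_fin]
    rw [← Nat.cast_smul_eq_nsmul ℝ, smul_inv_smul₀ (by positivity)]
    rfl
  calc dist (v i) (tupleBarycenter v)
      = ‖∑ j, (↑(n + 1) : ℝ)⁻¹ • ((v i).1 - (v j).1)‖ := by
        rw [Subtype.dist_eq, dist_eq_norm, hsum]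
    _ ≤ ∑ j, (↑(n + 1) : ℝ)⁻¹ * dist (v i) (v j) := by
        refine (norm_sum_le _ _).trans_eq (Finset.sum_congr rfl fun j _ => ?_)
        rw [norm_smul, Real.norm_of_nonneg (by positivity), Subtype.dist_eq, dist_eq_norm]
    _ = ∑ j ∈ Finset.univ.erase i, (↑(n + 1) : ℝ)⁻¹ * dist (v i) (v j) := by
        rw [Finset.sum_erase _ (by rw [dist_self, mul_zero])]
    _ ≤ ∑ _ ∈ Finset.univ.erase i, (↑(n + 1) : ℝ)⁻¹ * d := by
        gcongr
        exact h _ _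
    _ = (1 - (↑(n + 1) : ℝ)⁻¹) * d := by
        rw [Finset.sum_const, Finset.card_erase_of_mem (Finset.mem_univ i), Finset.card_univ,
          Fintype.card_fin, nsmul_eq_mul]
        push_cast [Nat.add_sub_cancel]
        field_simp
        ring

theorem IsSubdivisionSimplex.dist_le {n : ℕ} {v u : Fin n → stdSimplex ℝ κ}
    (h : IsSubdivisionSimplex tupleBarycenter v u) {q : stdSimplex ℝ κ} {e : ℝ}
    (hv : ∀ i, dist (v i) q ≤ e) (i : Fin n) : dist (u i) q ≤ e := by
  induction h with
  | nil => exact hv i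
  | cons _ ih =>
    induction i using Fin.cases with
    | zero => exact dist_affineSimplex_le _ _ hv
    | succ i => exact ih (fun _ => hv _) i

theorem IsSubdivisionSimplex.dist_le_mul {n : ℕ} {v u : Fin n → stdSimplex ℝ κ}
    (h : IsSubdivisionSimplex tupleBarycenter v u) {d : ℝ} (hv : ∀ i j, dist (v i) (v j) ≤ d)
    (i j : Fin n) : dist (u i) (u j) ≤ (1 - (n : ℝ)⁻¹) * d := by
  induction h with
  | nil => exact i.elim0
  | @cons n v _ u h ih =>
    have hd : 0 ≤ d := dist_nonneg.trans (hv 0 0)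
    have hapex (a : Fin n) : dist (u a) (tupleBarycenter v) ≤ (1 - (↑(n + 1) : ℝ)⁻¹) * d :=
      h.dist_le (fun _ => dist_tupleBarycenter_le v hv _) a
    induction i using Fin.cases with
    | zero =>
      induction j using Fin.cases with
      | zero =>
        rw [dist_self]
        exact mul_nonneg (sub_nonneg.2 (Nat.cast_inv_le_one _)) hd
      | succ b => exact (dist_comm _ _).trans_le (hapex b)
    | succ a =>
      induction j using Fin.cases with
      | zero => exact hapex a
      | succ b =>
        refine (ih (fun _ _ => hv _ _) a b).trans ?_
        have : (0 : ℝ) < n := Nat.cast_pos.2 a.pos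
        gcongr
        exact n.le_succ

theorem tupleSd_pow_single_mem_supported {n : ℕ} (v : Fin n → stdSimplex ℝ κ) {d : ℝ}
    (hv : ∀ i j, dist (v i) (v j) ≤ d) (N : ℕ) :
    (tupleSd k tupleBarycenter n ^ N) (.single v 1) ∈ Finsupp.supported k k
      {u : Fin n → stdSimplex ℝ κ | ∀ i j, dist (u i) (u j) ≤ (1 - (n : ℝ)⁻¹) ^ N * d} := by
  induction N with
  | zero => exact Finsupp.single_mem_supported k _ (by simpa using hv)
  | succ N ih =>
    rw [pow_succ' (tupleSd k tupleBarycenter n), Module.End.mul_apply]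
    refine map_mem_of_mem_supported (fun u hu => ?_) ih
    refine Finsupp.supported_mono (fun w hw => ?_) (tupleSd_single_mem_supported _ u)
    rw [Set.mem_ofPred_eq, pow_succ', mul_assoc]
    exact hw.dist_le_mul hu

end Mesh

section SmallChains

variable {k : Type u} [Field k] {X Y : Type} [TopologicalSpace X] [TopologicalSpace Y]

theorem singularChainsMap_injective {f : C(X, Y)} (hf : Function.Injective f) (n : ℕ) :
    Function.Injective ((singularChainsMap k f).f n) := by
  have hcomp : Function.Injective fun σ : C(stdSimplex ℝ (Fin (n + 1)), X) => f.comp σ :=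
    fun _ _ h => (ContinuousMap.cancel_left hf).1 h
  have hli := (singularBasis k Y n).linearIndependent.comp _ hcomp
  have hf' : (singularBasis k X n).constr k (singularBasis k Y n ∘ f.comp) =
      ((singularChainsMap k f).f n).hom :=
    (singularBasis k X n).constr_eq k fun σ => (singularChainsMap_singularBasis k f σ).symm
  change Function.Injective ((singularChainsMap k f).f n).hom
  exact hf' ▸ (singularBasis k X n).injective_constr_of_linearIndependent hli

/-- The inclusion of a subspace, as a continuous map. -/
def subspaceInclusion (A : Set X) : C(A, X) := ⟨Subtype.val, continuous_subtype_val⟩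

variable (k) in
/-- The singular chains of `X` that lie in `A`, as the image of the chains of the subspace `A`. -/
def chainsIn (A : Set X) (n : ℕ) : Submodule k ((singularChains k X).X n) :=
  LinearMap.range ((singularChainsMap k (subspaceInclusion A)).f n).hom

theorem chainsIn_eq_span (A : Set X) (n : ℕ) :
    chainsIn k A n = Submodule.span k (singularBasis k X n '' {σ | ∀ t, σ t ∈ A}) := by
  rw [chainsIn, LinearMap.range_eq_map, ← (singularBasis k A n).span_eq, Submodule.map_span,
    ← Set.range_comp]
  congr 1
  ext x
  constructor
  · rintro ⟨σ, rfl⟩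
    exact ⟨_, fun t => (σ t).2, (singularChainsMap_singularBasis k _ σ).symm⟩
  · rintro ⟨σ, hσ, rfl⟩
    exact ⟨⟨fun t => ⟨σ t, hσ t⟩, by fun_prop⟩, singularChainsMap_singularBasis k _ _⟩

theorem chainsIn_inf_chainsIn (A B : Set X) (n : ℕ) :
    chainsIn k A n ⊓ chainsIn k B n = chainsIn k (A ∩ B) n := by
  ext x
  simp only [chainsIn_eq_span, Submodule.mem_inf, Module.Basis.mem_span_image, Set.subset_def,
    Set.mem_ofPred_eq, Set.mem_inter_iff, forall_and]

theorem d_mem_chainsIn {A : Set X} {n : ℕ} {x : (singularChains k X).X (n + 1)}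
    (hx : x ∈ chainsIn k A (n + 1)) : (singularChains k X).d (n + 1) n x ∈ chainsIn k A n := by
  obtain ⟨a, rfl⟩ := hx
  exact ⟨(singularChains k A).d (n + 1) n a,
    congr($((singularChainsMap k (subspaceInclusion A)).comm (n + 1) n) a).symm⟩

theorem singularSd_pow_mem_chainsIn {A : Set X} {n : ℕ} {x : (singularChains k X).X n}
    (hx : x ∈ chainsIn k A n) (N : ℕ) : (singularSd k X n ^ N) x ∈ chainsIn k A n := by
  obtain ⟨a, rfl⟩ := hx
  exact ⟨(singularSd k A n ^ N) a, singularChainsMap_singularSd_pow _ N a⟩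

theorem singularSd_pow_mem_sup {A B : Set X} {n : ℕ} {x : (singularChains k X).X n}
    (hx : x ∈ chainsIn k A n ⊔ chainsIn k B n) (N : ℕ) :
    (singularSd k X n ^ N) x ∈ chainsIn k A n ⊔ chainsIn k B n := by
  obtain ⟨a, ha, b, hb, rfl⟩ := Submodule.mem_sup.1 hx
  rw [map_add]
  exact Submodule.add_mem_sup (singularSd_pow_mem_chainsIn ha N) (singularSd_pow_mem_chainsIn hb N)

theorem singularSd_pow_affineChain {κ : Type*} [Fintype κ] (σ : C(stdSimplex ℝ κ, X)) {n : ℕ}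
    (N : ℕ) (c : TupleChain k (stdSimplex ℝ κ) (n + 1)) :
    (singularSd k X n ^ N) (affineChain k σ n c) =
      affineChain k σ n ((tupleSd k tupleBarycenter (n + 1) ^ N) c) := by
  induction N generalizing c with
  | zero => rfl
  | succ N ih =>
    rw [pow_succ (singularSd k X n), pow_succ (tupleSd k tupleBarycenter (n + 1)),
      Module.End.mul_apply, Module.End.mul_apply, singularSd_affineChain, ih]

theorem exists_singularSd_pow_singularBasis_mem_sup {A B : Set X} (hA : IsOpen A) (hB : IsOpen B)
    (hAB : A ∪ B = Set.univ) {n : ℕ} (σ : C(stdSimplex ℝ (Fin (n + 1)), X)) :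
    ∃ N, (singularSd k X n ^ N) (singularBasis k X n σ) ∈ chainsIn k A n ⊔ chainsIn k B n := by
  obtain ⟨δ, hδ, hball⟩ : ∃ δ > 0, ∀ t, Metric.ball t δ ⊆ σ ⁻¹' A ∨ Metric.ball t δ ⊆ σ ⁻¹' B := by
    obtain ⟨δ, hδ, hball⟩ := lebesgue_number_lemma_of_metric_sUnion isCompact_univ
      (c := {σ ⁻¹' A, σ ⁻¹' B}) (by simp [hA.preimage σ.continuous, hB.preimage σ.continuous])
      (by rw [Set.sUnion_pair, ← Set.preimage_union, hAB, Set.preimage_univ])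
    exact ⟨δ, hδ, fun t => by simpa using hball t (Set.mem_univ t)⟩
  obtain ⟨N, hN⟩ : ∃ N : ℕ, (1 - (↑(n + 1) : ℝ)⁻¹) ^ N *
      Metric.diam (Set.univ : Set (stdSimplex ℝ (Fin (n + 1)))) < δ := by
    have hlim := (tendsto_pow_atTop_nhds_zero_of_lt_one
      (sub_nonneg.2 (Nat.cast_inv_le_one (n + 1))) (sub_lt_self 1 (by positivity))).mul_const
        (Metric.diam (Set.univ : Set (stdSimplex ℝ (Fin (n + 1)))))
    exact (hlim.eventually_lt_const (by rwa [zero_mul])).exists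
  have hdiam (s t : stdSimplex ℝ (Fin (n + 1))) : dist s t ≤ Metric.diam Set.univ :=
    Metric.dist_le_diam_of_mem isCompact_univ.isBounded (Set.mem_univ s) (Set.mem_univ t)
  refine ⟨N, ?_⟩
  rw [← affineChain_fundamentalTuple, singularSd_pow_affineChain]
  refine map_mem_of_mem_supported (f := affineChain k σ n) (fun u hu => ?_)
    (tupleSd_pow_single_mem_supported _ (fun _ _ => hdiam _ _) N)
  have hu' (t) : affineSimplex u t ∈ Metric.ball (u 0) δ :=
    (dist_affineSimplex_le u t fun i => hu i 0).trans_lt hN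
  rw [affineChain_single, chainsIn_eq_span, chainsIn_eq_span]
  rcases hball (u 0) with h | h
  · exact Submodule.mem_sup_left <|
      Submodule.subset_span (Set.mem_image_of_mem _ fun t => h (hu' t))
  · exact Submodule.mem_sup_right <|
      Submodule.subset_span (Set.mem_image_of_mem _ fun t => h (hu' t))

theorem exists_singularSd_pow_mem_sup {A B : Set X} (hA : IsOpen A) (hB : IsOpen B)
    (hAB : A ∪ B = Set.univ) {n : ℕ} (x : (singularChains k X).X n) :
    ∃ N, (singularSd k X n ^ N) x ∈ chainsIn k A n ⊔ chainsIn k B n := by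
  have hx : x ∈ Submodule.span k (Set.range (singularBasis k X n)) :=
    (singularBasis k X n).mem_span x
  induction hx using Submodule.span_induction with
  | mem _ h =>
    obtain ⟨σ, rfl⟩ := h
    exact exists_singularSd_pow_singularBasis_mem_sup hA hB hAB σ
  | zero => exact ⟨0, Submodule.zero_mem _⟩
  | add x y _ _ hx hy =>
    obtain ⟨N, hN⟩ := hx
    obtain ⟨M, hM⟩ := hy
    refine ⟨M + N, ?_⟩
    rw [map_add]
    refine Submodule.add_mem _ ?_ ?_
    · rw [pow_add, Module.End.mul_apply]
      exact singularSd_pow_mem_sup hN M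
    · rw [add_comm M N, pow_add, Module.End.mul_apply]
      exact singularSd_pow_mem_sup hM N
  | smul c x _ hx =>
    obtain ⟨N, hN⟩ := hx
    exact ⟨N, by simpa only [map_smul] using Submodule.smul_mem _ c hN⟩

end SmallChains

section MayerVietoris

variable {k : Type u} [Field k] {X D : Type} [TopologicalSpace X] [TopologicalSpace D]

theorem exists_mem_chainsIn_d_eq {A U : Set X} (hUA : U ⊆ A) {r : C(X, D)} {n : ℕ}
    (hr : Function.Injective (singularHomologyMap k (r.comp (subspaceInclusion A)) n))
    {z : (singularChains k U).cycles n}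
    (hz : singularHomologyMap k (r.comp (subspaceInclusion U)) n
      ((singularChains k U).homologyπ n z) = 0) :
    ∃ a ∈ chainsIn k A (n + 1), (singularChains k X).d (n + 1) n a =
      (singularChainsMap k (subspaceInclusion U)).f n ((singularChains k U).iCycles n z) := by
  have hcomp : (subspaceInclusion A).comp (ContinuousMap.inclusion hUA) = subspaceInclusion U :=
    rfl
  have h₀ : singularHomologyMap k (ContinuousMap.inclusion hUA) n
      ((singularChains k U).homologyπ n z) = 0 := by
    refine hr ?_
    rw [map_zero, ← singularHomologyMap_comp_apply]
    exact hz
  rw [homologyMap_homologyπ, homologyπ_eq_zero_iff (ChainComplex.prev ℕ n)] at h₀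
  obtain ⟨a, ha⟩ := h₀
  rw [iCycles_cyclesMap] at ha
  refine ⟨_, ⟨a, rfl⟩, ?_⟩
  rw [← hcomp, singularChainsMap_comp]
  exact congr($((singularChainsMap k (subspaceInclusion A)).comm (n + 1) n) a).trans
    (congrArg _ ha)

theorem homologyπ_eq_zero_of_d_eq_sub {A B : Set X} (hA : IsOpen A) (hB : IsOpen B)
    (hAB : A ∪ B = Set.univ) {n : ℕ} {z : (singularChains k ↥(A ∩ B)).cycles n}
    {a b : (singularChains k X).X (n + 1)} (ha : a ∈ chainsIn k A (n + 1))
    (hb : b ∈ chainsIn k B (n + 1))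
    (hz : (singularChains k X).d (n + 1) n a =
      (singularChainsMap k (subspaceInclusion (A ∩ B))).f n
        ((singularChains k ↥(A ∩ B)).iCycles n z))
    {e : (singularChains k X).X (n + 2)} (he : (singularChains k X).d (n + 2) (n + 1) e = a - b) :
    (singularChains k ↥(A ∩ B)).homologyπ n z = 0 := by
  set ι := singularChainsMap k (subspaceInclusion (A ∩ B))
  set x := (singularChains k ↥(A ∩ B)).iCycles n z
  obtain ⟨N, hN⟩ := exists_singularSd_pow_mem_sup hA hB hAB e
  obtain ⟨p, hp, q, hq, hpq⟩ := Submodule.mem_sup.1 hN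
  have hdpq : (singularSd k X (n + 1) ^ N) a - (singularChains k X).d (n + 2) (n + 1) p =
      (singularSd k X (n + 1) ^ N) b + (singularChains k X).d (n + 2) (n + 1) q := by
    rw [sub_eq_iff_eq_add, add_assoc, ← map_add, add_comm q p, hpq, d_singularSd_pow, he, map_sub,
      add_sub_cancel]
  obtain ⟨w, hw⟩ : (singularSd k X (n + 1) ^ N) a - (singularChains k X).d (n + 2) (n + 1) p ∈
      chainsIn k (A ∩ B) (n + 1) := by
    rw [← chainsIn_inf_chainsIn]
    refine ⟨sub_mem (singularSd_pow_mem_chainsIn ha N) (d_mem_chainsIn hp), ?_⟩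
    rw [hdpq]
    exact add_mem (singularSd_pow_mem_chainsIn hb N) (d_mem_chainsIn hq)
  have hdw : (singularChains k ↥(A ∩ B)).d (n + 1) n w = (singularSd k ↥(A ∩ B) n ^ N) x := by
    refine singularChainsMap_injective Subtype.val_injective n (f := subspaceInclusion (A ∩ B)) ?_
    calc ι.f n ((singularChains k ↥(A ∩ B)).d (n + 1) n w)
        = (singularChains k X).d (n + 1) n (ι.f (n + 1) w) := congr($(ι.comm (n + 1) n) w).symm
      _ = (singularSd k X n ^ N) ((singularChains k X).d (n + 1) n a) := by
        refine (congrArg _ hw).trans ?_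
        rw [map_sub, d_singularSd_pow]
        exact (congrArg _ congr($((singularChains k X).d_comp_d (n + 2) (n + 1) n) p)).trans
          (sub_zero _)
      _ = ι.f n ((singularSd k ↥(A ∩ B) n ^ N) x) := by
        rw [hz, singularChainsMap_singularSd_pow]
  obtain ⟨y, hy⟩ := exists_d_eq_sub_singularSd_pow (fun j => d_iCycles n j z) N
  refine (homologyπ_eq_zero_iff (ChainComplex.prev ℕ n) z).2 ⟨y + w, ?_⟩
  rw [map_add, hy, hdw, sub_add_cancel]

variable (k) in
/-- The triples `(z, a, b)` of a cycle `z` of `A ∩ B` and chains `a` of `A` and `b` of `B` that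
both have boundary `z`. These are the representatives of the classes in `H_{n+1}(X; k)` which the
Mayer–Vietoris connecting map sends to the class of `z`. -/
def boundingTriples (A B : Set X) (n : ℕ) :
    Submodule k ((singularChains k ↥(A ∩ B)).cycles n ×
      (singularChains k X).X (n + 1) × (singularChains k X).X (n + 1)) where
  carrier := {t | t.2.1 ∈ chainsIn k A (n + 1) ∧ t.2.2 ∈ chainsIn k B (n + 1) ∧
    (singularChains k X).d (n + 1) n t.2.1 = (singularChainsMap k (subspaceInclusion (A ∩ B))).f n
      ((singularChains k ↥(A ∩ B)).iCycles n t.1) ∧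
    (singularChains k X).d (n + 1) n t.2.2 = (singularChainsMap k (subspaceInclusion (A ∩ B))).f n
      ((singularChains k ↥(A ∩ B)).iCycles n t.1)}
  add_mem' hs ht := ⟨add_mem hs.1 ht.1, add_mem hs.2.1 ht.2.1,
    by simp only [Prod.fst_add, Prod.snd_add, map_add, hs.2.2.1, ht.2.2.1],
    by simp only [Prod.fst_add, Prod.snd_add, map_add, hs.2.2.2, ht.2.2.2]⟩
  zero_mem' := ⟨zero_mem _, zero_mem _, by simp, by simp⟩
  smul_mem' c t ht := ⟨Submodule.smul_mem _ c ht.1, Submodule.smul_mem _ c ht.2.1,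
    by simp only [Prod.smul_fst, Prod.smul_snd, map_smul, ht.2.2.1],
    by simp only [Prod.smul_fst, Prod.smul_snd, map_smul, ht.2.2.2]⟩

/-- The cycle `a - b` glued from a triple `(z, a, b)`. -/
def gluedChain (A B : Set X) (n : ℕ) :
    boundingTriples k A B n →ₗ[k] (singularChains k X).X (n + 1) :=
  (LinearMap.fst k _ _ - LinearMap.snd k _ _) ∘ₗ LinearMap.snd k _ _ ∘ₗ
    (boundingTriples k A B n).subtype

theorem d_gluedChain (A B : Set X) (n j : ℕ) (t : boundingTriples k A B n) :
    (singularChains k X).d (n + 1) j (gluedChain A B n t) = 0 := by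
  by_cases hj : j + 1 = n + 1
  · obtain rfl := Nat.succ_injective hj
    exact (map_sub ((singularChains k X).d (j + 1) j).hom t.1.2.1 t.1.2.2).trans
      (sub_eq_zero.2 (t.2.2.2.1.trans t.2.2.2.2.symm))
  · exact congr($((singularChains k X).shape _ _ hj) (gluedChain A B n t))

/-- The homology class of `a - b`, for a triple `(z, a, b)`. -/
def gluedClass (A B : Set X) (n : ℕ) :
    boundingTriples k A B n →ₗ[k] (singularChains k X).homology (n + 1) :=
  homologyClass (gluedChain A B n) (d_gluedChain A B n)

theorem exists_gluedClass_eq {A B : Set X} {n : ℕ} (t : boundingTriples k A B n) :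
    ∃ c, (singularChains k X).iCycles (n + 1) c = t.1.2.1 - t.1.2.2 ∧
      gluedClass A B n t = (singularChains k X).homologyπ (n + 1) c :=
  exists_homologyClass_eq (gluedChain A B n) (d_gluedChain A B n) t

theorem homologyπ_eq_zero_of_gluedClass_eq_zero {A B : Set X} (hA : IsOpen A) (hB : IsOpen B)
    (hAB : A ∪ B = Set.univ) {n : ℕ} {t : boundingTriples k A B n} (ht : gluedClass A B n t = 0) :
    (singularChains k ↥(A ∩ B)).homologyπ n t.1.1 = 0 := by
  obtain ⟨c, hc, htc⟩ := exists_gluedClass_eq t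
  obtain ⟨e, he⟩ := (homologyπ_eq_zero_iff (ChainComplex.prev ℕ (n + 1)) c).1 (htc.symm.trans ht)
  exact homologyπ_eq_zero_of_d_eq_sub hA hB hAB t.2.1 t.2.2.1 t.2.2.2.1 (he.trans hc)

theorem singularHomologyMap_homologyπ_eq_zero {A B : Set X} (r : C(X, D)) {n : ℕ}
    (t : boundingTriples k A B n) :
    singularHomologyMap k (r.comp (subspaceInclusion (A ∩ B))) n
      ((singularChains k ↥(A ∩ B)).homologyπ n t.1.1) = 0 := by
  rw [homologyMap_homologyπ, homologyπ_eq_zero_iff (ChainComplex.prev ℕ n)]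
  refine ⟨(singularChainsMap k r).f (n + 1) t.1.2.1, ?_⟩
  rw [iCycles_cyclesMap, singularChainsMap_comp]
  exact congr($((singularChainsMap k r).comm (n + 1) n) t.1.2.1).trans (congrArg _ t.2.2.2.1)

/-- A cycle of `A`, as the triple `(0, c, 0)`. -/
def cycleTriple (A B : Set X) {n : ℕ} (c : (singularChains k A).cycles (n + 1)) :
    boundingTriples k A B n :=
  ⟨(0, (singularChainsMap k (subspaceInclusion A)).f (n + 1)
    ((singularChains k A).iCycles (n + 1) c), 0), ⟨_, rfl⟩, zero_mem _, by
      rw [map_zero, map_zero]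
      refine congr($((singularChainsMap k (subspaceInclusion A)).comm (n + 1) n) _).trans ?_
      rw [ModuleCat.comp_apply, d_iCycles, map_zero], by simp⟩

theorem gluedClass_cycleTriple (A B : Set X) {n : ℕ} (c : (singularChains k A).cycles (n + 1)) :
    gluedClass A B n (cycleTriple A B c) = singularHomologyMap k (subspaceInclusion A) (n + 1)
      ((singularChains k A).homologyπ (n + 1) c) := by
  obtain ⟨c', hc', h⟩ := exists_gluedClass_eq (cycleTriple A B c)
  rw [h, homologyMap_homologyπ]
  refine congrArg _ (iCycles_injective _ ?_)
  rw [hc', iCycles_cyclesMap]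
  exact sub_zero _

theorem exists_boundingTriple {A B : Set X} {r : C(X, D)} {n : ℕ}
    (hrA : ∀ n, Function.Bijective (singularHomologyMap k (r.comp (subspaceInclusion A)) n))
    (hrB : Function.Injective (singularHomologyMap k (r.comp (subspaceInclusion B)) n))
    {z : (singularChains k ↥(A ∩ B)).cycles n}
    (hz : singularHomologyMap k (r.comp (subspaceInclusion (A ∩ B))) n
      ((singularChains k ↥(A ∩ B)).homologyπ n z) = 0)
    (y : (singularChains k D).homology (n + 1)) :
    ∃ t : boundingTriples k A B n,
      t.1.1 = z ∧ singularHomologyMap k r (n + 1) (gluedClass A B n t) = y := by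
  obtain ⟨a, ha, hza⟩ := exists_mem_chainsIn_d_eq Set.inter_subset_left (hrA n).1 hz
  obtain ⟨b, hb, hzb⟩ := exists_mem_chainsIn_d_eq Set.inter_subset_right hrB hz
  let t : boundingTriples k A B n := ⟨(z, a, b), ha, hb, hza, hzb⟩
  obtain ⟨x, hx⟩ := (hrA (n + 1)).2 (y - singularHomologyMap k r (n + 1) (gluedClass A B n t))
  obtain ⟨c, rfl⟩ := homologyπ_surjective _ x
  refine ⟨t + cycleTriple A B c, add_zero z, ?_⟩
  rw [map_add, map_add, gluedClass_cycleTriple,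
    ← singularHomologyMap_comp_apply, hx, add_sub_cancel]

theorem rank_ker_add_rank_le {A B : Set X} (hA : IsOpen A) (hB : IsOpen B)
    (hAB : A ∪ B = Set.univ) {r : C(X, D)} (n : ℕ)
    (hrA : ∀ n, Function.Bijective (singularHomologyMap k (r.comp (subspaceInclusion A)) n))
    (hrB : Function.Injective (singularHomologyMap k (r.comp (subspaceInclusion B)) n)) :
    Module.rank k (LinearMap.ker
        (singularHomologyMap k (r.comp (subspaceInclusion (A ∩ B))) n)) +
      Module.rank k ((singularChains k D).homology (n + 1)) ≤
      Module.rank k ((singularChains k X).homology (n + 1)) := by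
  let π : boundingTriples k A B n →ₗ[k]
      LinearMap.ker (singularHomologyMap k (r.comp (subspaceInclusion (A ∩ B))) n) :=
    (((singularChains k ↥(A ∩ B)).homologyπ n).hom ∘ₗ LinearMap.fst k _ _ ∘ₗ
      (boundingTriples k A B n).subtype).codRestrict _ (singularHomologyMap_homologyπ_eq_zero r)
  rw [← rank_prod']
  refine rank_le_of_surjective_of_ker_le (gluedClass A B n)
    (π.prod (singularHomologyMap k r (n + 1) ∘ₗ gluedClass A B n)) ?_ fun t ht => ?_
  · rintro ⟨⟨x, hx⟩, y⟩
    obtain ⟨z, rfl⟩ := homologyπ_surjective n x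
    obtain ⟨t, rfl, rfl⟩ := exists_boundingTriple hrA hrB hx y
    exact ⟨t, rfl⟩
  · rw [LinearMap.mem_ker] at ht ⊢
    refine Prod.ext (Subtype.ext (homologyπ_eq_zero_of_gluedClass_eq_zero hA hB hAB ht)) ?_
    exact (congrArg (singularHomologyMap k r (n + 1)) ht).trans (map_zero _)

theorem totalHomologyDim_inter_le {A B : Set X} (hA : IsOpen A) (hB : IsOpen B)
    (hAB : A ∪ B = Set.univ) (r : C(X, D))
    (hrA : ∀ n, Function.Bijective (singularHomologyMap k (r.comp (subspaceInclusion A)) n))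
    (hrB : ∀ n, Function.Injective (singularHomologyMap k (r.comp (subspaceInclusion B)) n)) :
    totalHomologyDim k ↥(A ∩ B) ≤ totalHomologyDim k X := by
  let h (Y : Type) [TopologicalSpace Y] (n : ℕ) := Module.rank k ((singularChains k Y).homology n)
  let κ (n : ℕ) := Module.rank k (LinearMap.ker
    (singularHomologyMap k (r.comp (subspaceInclusion (A ∩ B))) n))
  have h₀ : h D 0 ≤ h X 0 := by
    refine LinearMap.rank_le_of_surjective (singularHomologyMap k r 0) fun y => ?_
    obtain ⟨x, rfl⟩ := (hrA 0).2 y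
    exact ⟨singularHomologyMap k (subspaceInclusion A) 0 x, by
      rw [← singularHomologyMap_comp_apply]⟩
  calc Cardinal.sum (h ↥(A ∩ B)) ≤ Cardinal.sum (κ + h D) := by
        refine Cardinal.sum_le_sum _ _ fun n => ?_
        change Module.rank k _ ≤ Module.rank k _ + Module.rank k _
        rw [← LinearMap.rank_range_add_rank_ker
          (singularHomologyMap k (r.comp (subspaceInclusion (A ∩ B))) n), add_comm]
        exact add_le_add_right (Submodule.rank_le _) _
    _ = h D 0 + Cardinal.sum (κ + fun n => h D (n + 1)) := by
        rw [Cardinal.sum_add_distrib, Cardinal.sum_add_distrib,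
          Cardinal.sum_nat_eq_add_sum_succ (h D), add_left_comm]
    _ ≤ h X 0 + Cardinal.sum fun n => h X (n + 1) :=
        add_le_add h₀ <| Cardinal.sum_le_sum _ _ fun n =>
          rank_ker_add_rank_le hA hB hAB n hrA (hrB n)
    _ = Cardinal.sum (h X) := (Cardinal.sum_nat_eq_add_sum_succ (h X)).symm

end MayerVietoris

section Slices

variable {V : Type} [DecidableEq V] {Z : Set (V → ℝ)} {v : V}

/-- Every line parallel to the `v`-axis meets `Z` in `∅`, `{-1, 1}` or `[-1, 1]`. Thus `Z` is the
double of its half `0 ≤ x v` along its slice `x v = 0`. -/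
structure IsDoubleAlong (Z : Set (V → ℝ)) (v : V) : Prop where
  abs_le_one : ∀ x ∈ Z, |x v| ≤ 1
  update_mem : ∀ x ∈ Z, ∀ t : ℝ, |t| = 1 → Function.update x v t ∈ Z
  update_mem_of_abs_lt_one :
    ∀ x ∈ Z, |x v| < 1 → ∀ t : ℝ, |t| ≤ 1 → Function.update x v t ∈ Z

theorem lineMap_ne_neg {c s t : ℝ} (hc : |c| = 1) (hs : |s| ≤ 1) (hsc : s ≠ -c)
    (ht₁ : t ≤ 1) : AffineMap.lineMap c s t ≠ -c := by
  rw [AffineMap.lineMap_apply_ring]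
  intro h
  obtain ⟨hs₁, hs₂⟩ := abs_le.1 hs
  rcases eq_or_eq_neg_of_abs_eq hc with rfl | rfl
  · nlinarith [lt_of_le_of_ne hs₁ hsc.symm, mul_nonneg (sub_nonneg.2 ht₁) (sub_nonneg.2 hs₂)]
  · rw [neg_neg] at hsc
    nlinarith [lt_of_le_of_ne hs₂ hsc, mul_nonneg (sub_nonneg.2 ht₁) (neg_le_iff_add_nonneg.1 hs₁)]

namespace IsDoubleAlong

/-- The map which moves the coordinate `v` of the points of `Z` to `1`. -/
def toOne (hZ : IsDoubleAlong Z v) : C(Z, {x | x ∈ Z ∧ x v = 1}) :=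
  ⟨fun x => ⟨Function.update x.1 v 1, hZ.update_mem _ x.2 _ abs_one, by simp⟩, by fun_prop⟩

theorem update_lineMap_mem (hZ : IsDoubleAlong Z v) {c : ℝ} (hc : |c| = 1) {x : V → ℝ}
    (hx : x ∈ Z) (hxc : x v ≠ -c) {t : ℝ} (ht₀ : 0 ≤ t) (ht₁ : t ≤ 1) :
    Function.update x v (AffineMap.lineMap c (x v) t) ∈ Z := by
  rcases (hZ.abs_le_one x hx).lt_or_eq with h | h
  · refine hZ.update_mem_of_abs_lt_one x hx h _ (abs_le.2 ?_)
    exact (convex_Icc (-1) 1).lineMap_mem (abs_le.1 hc.le) (abs_le.1 h.le) ⟨ht₀, ht₁⟩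
  · rw [((abs_eq_abs.1 (h.trans hc.symm)).resolve_right hxc), AffineMap.lineMap_same_apply]
    exact hZ.update_mem x hx c hc

/-- Off the face `x v = -c`, moving the coordinate `v` to `1` is a homotopy equivalence, because
`x v` can be moved to `c` along a segment. -/
def homotopyEquivToOne (hZ : IsDoubleAlong Z v) {c : ℝ} (hc : |c| = 1) :
    {x : Z | x.1 v ≠ -c} ≃ₕ {x | x ∈ Z ∧ x v = 1} where
  toFun := hZ.toOne.comp (subspaceInclusion _)
  invFun := ⟨fun y => ⟨⟨Function.update y.1 v c, hZ.update_mem _ y.2.1 _ hc⟩, by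
    simpa [self_eq_neg] using abs_pos.1 (hc ▸ one_pos)⟩, by fun_prop⟩
  left_inv := ⟨{
    toFun := fun p => ⟨⟨Function.update p.2.1.1 v (AffineMap.lineMap c (p.2.1.1 v) (p.1 : ℝ)),
      hZ.update_lineMap_mem hc p.2.1.2 p.2.2 p.1.2.1 p.1.2.2⟩, by
        simpa using lineMap_ne_neg hc (hZ.abs_le_one _ p.2.1.2) p.2.2 p.1.2.2⟩
    continuous_toFun := by
      have hx : Continuous fun p : unitInterval × {x : Z | x.1 v ≠ -c} => p.2.1.1 := by fun_prop
      have hline := (continuous_const (y := c)).lineMap ((continuous_apply v).comp hx)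
        (continuous_subtype_val.comp continuous_fst)
      exact .subtype_mk (.subtype_mk (hx.update v hline) _) _
    map_zero_left := fun x => by
      ext i
      simp [toOne, subspaceInclusion]
    map_one_left := fun x => by
      ext i
      simp }⟩
  right_inv := by
    convert ContinuousMap.Homotopic.refl _ using 1
    ext y i
    have := y.2.2
    simp [toOne, subspaceInclusion, Function.update_idem, ← this]

/-- To have open sets for Mayer–Vietoris, the two halves of `Z` are thickened to the complements of
the faces `x v = -1` and `x v = 1`. -/
theorem totalHomologyDim_slice_le (k : Type u) [Field k] (hZ : IsDoubleAlong Z v) :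
    totalHomologyDim k {x | x ∈ Z ∧ x v = 0} ≤ totalHomologyDim k Z := by
  let A : Set Z := {x | x.1 v ≠ -1}
  let B : Set Z := {x | x.1 v ≠ - -1}
  have hopen (c : ℝ) : IsOpen {x : Z | x.1 v ≠ c} :=
    isOpen_ne.preimage ((continuous_apply v).comp continuous_subtype_val)
  have hAB : A ∪ B = Set.univ := Set.eq_univ_of_forall fun x =>
    or_iff_not_imp_left.2 fun h => by
      have : x.1 v = -1 := not_not.1 h
      simp only [B, Set.mem_ofPred_eq, this]
      norm_num
  have habs (x : ↥(A ∩ B)) : |x.1.1 v| < 1 :=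
    (hZ.abs_le_one _ x.1.2).lt_of_ne fun h => (eq_or_eq_neg_of_abs_eq h).elim
      (fun h => x.2.2 (by rw [h, neg_neg])) x.2.1
  let i : C({x | x ∈ Z ∧ x v = 0}, ↥(A ∩ B)) :=
    ⟨fun x => ⟨⟨x.1, x.2.1⟩, by simp [A, B, x.2.2]⟩, by fun_prop⟩
  let p : C(↥(A ∩ B), {x | x ∈ Z ∧ x v = 0}) :=
    ⟨fun x => ⟨Function.update x.1.1 v 0,
      hZ.update_mem_of_abs_lt_one _ x.1.2 (habs x) _ (by simp), by simp⟩, by fun_prop⟩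
  have hpi : Function.LeftInverse p i := fun x =>
    Subtype.ext (Function.update_eq_self_iff.2 x.2.2.symm)
  exact (totalHomologyDim_le_of_leftInverse k hpi).trans <|
    totalHomologyDim_inter_le (hopen _) (hopen _) hAB hZ.toOne
      (singularHomologyMap_bijective k (hZ.homotopyEquivToOne abs_one))
      fun n => (singularHomologyMap_bijective k
        (hZ.homotopyEquivToOne (by simp : |(-1 : ℝ)| = 1)) n).1

end IsDoubleAlong

end Slices

section CubeProduct

variable {V : Type}

/-- The real moment-angle complex `⋃_{σ ∈ F} (D¹, S⁰)^σ ⊆ ℝ^V` of a family `F` of finite sets. -/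
def cubeProduct (F : Set (Finset V)) : Set (V → ℝ) :=
  {x | ∃ σ ∈ F, ∀ i, |x i| ≤ 1 ∧ (i ∉ σ → |x i| = 1)}

/-- The slice of `cubeProduct F` in which the coordinates in `τ` vanish. -/
def cubeSlice (F : Set (Finset V)) (τ : Finset V) : Set (V → ℝ) :=
  {x | x ∈ cubeProduct F ∧ ∀ i ∈ τ, x i = 0}

variable (k : Type u) [Field k] {F : Set (Finset V)}

theorem cubeSlice_empty : cubeSlice F ∅ = cubeProduct F := by
  simp [cubeSlice]

theorem cubeSlice_insert [DecidableEq V] (τ : Finset V) (v : V) :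
    cubeSlice F (insert v τ) = {x | x ∈ cubeSlice F τ ∧ x v = 0} := by
  ext x
  simp only [cubeSlice, Set.mem_ofPred_eq, Finset.forall_mem_insert, and_assoc]
  tauto

theorem isDoubleAlong_cubeSlice [DecidableEq V] {τ : Finset V} {v : V} (hv : v ∉ τ) :
    IsDoubleAlong (cubeSlice F τ) v := by
  have hupdate {x : V → ℝ} {σ : Finset V} {t : ℝ} (hσ : σ ∈ F)
      (hx : ∀ i, |x i| ≤ 1 ∧ (i ∉ σ → |x i| = 1)) (h₀ : ∀ i ∈ τ, x i = 0)
      (ht : |t| ≤ 1 ∧ (v ∉ σ → |t| = 1)) : Function.update x v t ∈ cubeSlice F τ := by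
    refine ⟨⟨σ, hσ, fun i => ?_⟩, fun i hi => ?_⟩
    · rcases eq_or_ne i v with rfl | hi
      · rwa [Function.update_self]
      · rw [Function.update_of_ne hi]
        exact hx i
    · rw [Function.update_of_ne (ne_of_mem_of_not_mem hi hv)]
      exact h₀ i hi
  constructor
  · rintro x ⟨⟨σ, -, hx⟩, -⟩
    exact (hx v).1
  · rintro x ⟨⟨σ, hσ, hx⟩, h₀⟩ t ht
    exact hupdate hσ hx h₀ ⟨ht.le, fun _ => ht⟩
  · rintro x ⟨⟨σ, hσ, hx⟩, h₀⟩ hxv t ht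
    exact hupdate hσ hx h₀ ⟨ht, fun hv => absurd ((hx v).2 hv) hxv.ne⟩

theorem totalHomologyDim_cubeSlice_le (τ : Finset V) :
    totalHomologyDim k (cubeSlice F τ) ≤ totalHomologyDim k (cubeProduct F) := by
  classical
  induction τ using Finset.induction_on with
  | empty => rw [cubeSlice_empty]
  | insert v τ hv ih =>
    rw [cubeSlice_insert]
    exact ((isDoubleAlong_cubeSlice hv).totalHomologyDim_slice_le k).trans ih

variable {σ : Finset V}

theorem finite_cubeSlice [Finite V] (hmax : ∀ ρ ∈ F, σ ⊆ ρ → ρ = σ) : (cubeSlice F σ).Finite := by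
  refine (Set.Finite.pi fun _ : V => Set.toFinite {(-1 : ℝ), 0, 1}).subset ?_
  rintro x ⟨⟨ρ, hρ, hx⟩, h₀⟩ i -
  have hσρ : σ ⊆ ρ := fun j hj => by
    by_contra hjρ
    simpa [h₀ j hj] using (hx j).2 hjρ
  by_cases hi : i ∈ σ
  · simp [h₀ i hi]
  · rcases eq_or_eq_neg_of_abs_eq ((hx i).2 (hmax ρ hρ hσρ ▸ hi)) with h | h <;> simp [h]

variable [Fintype V] [DecidableEq V]

theorem two_pow_le_lift_mk_cubeSlice (hσ : σ ∈ F) :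
    (2 : Cardinal.{u}) ^ σᶜ.card ≤ Cardinal.lift.{u} (Cardinal.mk (cubeSlice F σ)) := by
  have hunit (u : ℤˣ) : |((u : ℤ) : ℝ)| = 1 := by
    rw [← Int.cast_abs, Int.isUnit_iff_abs_eq.1 u.isUnit, Int.cast_one]
  let f (b : ↥σᶜ → ℤˣ) : cubeSlice F σ :=
    ⟨fun i => if h : i ∈ σᶜ then ((b ⟨i, h⟩ : ℤ) : ℝ) else 0,
      ⟨σ, hσ, fun i => by by_cases hi : i ∈ σ <;> simp [hi, hunit]⟩, fun i hi => by simp [hi]⟩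
  have hf : Function.Injective f := fun b b' h => funext fun i => Units.ext <| by
    simpa [f, dif_pos i.2, -Finset.mem_compl] using congrFun (congrArg Subtype.val h) i
  calc (2 : Cardinal.{u}) ^ σᶜ.card = Cardinal.lift.{u} (Cardinal.mk (↥σᶜ → ℤˣ)) := by
        rw [Cardinal.mk_fintype, Cardinal.lift_natCast]
        simp [Finset.card_compl]
    _ ≤ Cardinal.lift.{u} (Cardinal.mk (cubeSlice F σ)) :=
        Cardinal.lift_le.2 (Cardinal.mk_le_of_injective hf)

theorem two_pow_le_totalHomologyDim_cubeProduct (hσ : σ ∈ F)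
    (hmax : ∀ ρ ∈ F, σ ⊆ ρ → ρ = σ) :
    (2 : Cardinal.{u}) ^ σᶜ.card ≤ totalHomologyDim k (cubeProduct F) := by
  have : TotallyDisconnectedSpace (cubeSlice F σ) :=
    have := (finite_cubeSlice hmax).to_subtype
    inferInstance
  exact (two_pow_le_lift_mk_cubeSlice hσ).trans
    ((mk_le_totalHomologyDim k).trans (totalHomologyDim_cubeSlice_le k σ))

end CubeProduct

section Balls

theorem exists_homeomorph_norm_le_one_iff_and_norm_eq_one_iff {E F : Type*}
    [NormedAddCommGroup E] [NormedSpace ℝ E] [NormedAddCommGroup F] [NormedSpace ℝ F]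
    (e : E ≃L[ℝ] F) :
    ∃ g : E ≃ₜ F, (∀ z, ‖g z‖ ≤ 1 ↔ ‖z‖ ≤ 1) ∧ ∀ z, ‖g z‖ = 1 ↔ ‖z‖ = 1 := by
  have hint : interior (e '' Metric.closedBall 0 1) = e '' Metric.ball 0 1 := by
    rw [← interior_closedBall (0 : E) one_ne_zero]
    exact (e.toHomeomorph.image_interior _).symm
  have hclosure : closure (e '' Metric.closedBall 0 1) = e '' Metric.closedBall 0 1 :=
    (e.toHomeomorph.isClosedMap _ Metric.isClosed_closedBall).closure_eq
  have hfrontier : frontier (e '' Metric.closedBall 0 1) = e '' Metric.sphere 0 1 := by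
    rw [← frontier_closedBall (0 : E) one_ne_zero]
    exact (e.toHomeomorph.image_frontier _).symm
  obtain ⟨h, -, hball, hsphere⟩ := exists_homeomorph_image_interior_closure_frontier_eq_unitBall
    (s := e '' Metric.closedBall 0 1) ((convex_closedBall 0 1).linear_image e.toLinearMap)
    (by simpa only [hint] using (Metric.nonempty_ball.2 one_pos).image e)
    ((e : E →L[ℝ] F).lipschitz.isBounded_image Metric.isBounded_closedBall)
  rw [hclosure, ← Set.image_comp] at hball
  rw [hfrontier, ← Set.image_comp] at hsphere
  have hinj := h.injective.comp e.injective
  refine ⟨e.toHomeomorph.trans h, fun z => ?_, fun z => ?_⟩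
  · rw [← mem_closedBall_zero_iff, ← mem_closedBall_zero_iff, ← hball]
    exact hinj.mem_set_image
  · rw [← mem_sphere_zero_iff_norm, ← mem_sphere_zero_iff_norm, ← hsphere]
    exact hinj.mem_set_image

theorem pi_norm_eq_one_iff {ι : Type*} [Fintype ι] {x : ι → ℝ} (hx : ‖x‖ ≤ 1) :
    ‖x‖ = 1 ↔ ∃ i, |x i| = 1 := by
  refine ⟨fun h => ?_, fun ⟨i, hi⟩ => hx.antisymm (hi ▸ norm_le_pi_norm x i)⟩
  by_contra! hne
  exact h.not_lt ((pi_norm_lt_iff one_pos).2 fun i =>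
    ((norm_le_pi_norm x i).trans hx).lt_of_ne (hne i))

end Balls

section WedgeFamily

variable {V ι : Type}

/-- The simplicial wedge construction: each vertex `i` of `F` is replaced by the vertices `(i, j)`,
and the minimal non-members of the new family are the sets of all copies of the vertices in a
minimal non-member of `F`. It turns the discs `D^ι` into products of intervals. -/
def wedgeFamily (ι : Type) (F : Set (Finset V)) : Set (Finset (V × ι)) :=
  {τ | ∃ σ ∈ F, ∀ i, (∀ j, (i, j) ∈ τ) → i ∈ σ}

theorem mem_cubeProduct_wedgeFamily [Finite V] [Fintype ι] [Nonempty ι] {F : Set (Finset V)}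
    {x : V × ι → ℝ} : x ∈ cubeProduct (wedgeFamily ι F) ↔
      ∃ σ ∈ F, ∀ i, ‖fun j => x (i, j)‖ ≤ 1 ∧ (i ∉ σ → ‖fun j => x (i, j)‖ = 1) := by
  classical
  have := Fintype.ofFinite V
  constructor
  · rintro ⟨τ, ⟨σ, hσ, hτ⟩, hx⟩
    refine ⟨σ, hσ, fun i => ?_⟩
    have hle : ‖fun j => x (i, j)‖ ≤ 1 := (pi_norm_le_iff_of_nonempty _).2 fun j => (hx (i, j)).1
    refine ⟨hle, fun hi => (pi_norm_eq_one_iff hle).2 ?_⟩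
    by_contra! hne
    exact hi (hτ i fun j => by_contra fun hj => hne j ((hx (i, j)).2 hj))
  · rintro ⟨σ, hσ, hx⟩
    refine ⟨Finset.univ.filter fun p => |x p| ≠ 1, ⟨σ, hσ, fun i hi => ?_⟩, fun p => ⟨?_, ?_⟩⟩
    · by_contra hiσ
      obtain ⟨j, hj⟩ := (pi_norm_eq_one_iff (hx i).1).1 ((hx i).2 hiσ)
      exact (Finset.mem_filter.1 (hi j)).2 hj
    · exact (pi_norm_le_iff_of_nonempty _).1 (hx p.1).1 p.2
    · simp

variable [Fintype V] [Fintype ι] [DecidableEq V] [DecidableEq ι] {F : Set (Finset V)}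
  {σ : Finset V}

theorem compl_product_singleton_mem_wedgeFamily (hσ : σ ∈ F) (j₀ : ι) :
    (σᶜ ×ˢ {j₀})ᶜ ∈ wedgeFamily ι F :=
  ⟨σ, hσ, fun i hi => by simpa using hi j₀⟩

theorem eq_compl_product_singleton_of_subset (hmax : ∀ ρ ∈ F, σ ⊆ ρ → ρ = σ) (j₀ : ι)
    {τ : Finset (V × ι)} (hτ : τ ∈ wedgeFamily ι F) (hστ : (σᶜ ×ˢ {j₀})ᶜ ⊆ τ) :
    τ = (σᶜ ×ˢ {j₀})ᶜ := by
  obtain ⟨ρ, hρ, hτρ⟩ := hτ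
  have hρσ : ρ = σ := hmax ρ hρ fun i hi => hτρ i fun j => hστ (by simp [hi])
  refine subset_antisymm (fun ⟨i, j⟩ hij => ?_) hστ
  by_contra h
  obtain ⟨hi, rfl⟩ : i ∉ σ ∧ j₀ = j := by simpa using h
  refine hi (hρσ ▸ hτρ i fun j' => ?_)
  by_cases hj : j₀ = j'
  · rwa [← hj]
  · exact hστ (by simp [hj])

end WedgeFamily

section PolyhedralProduct

variable {m : ℕ} (k : Type u) [Field k] (K : PreAbstractSimplicialComplex (Fin m))

theorem mem_polyhedralProduct_iff {E : Type*} [SeminormedAddCommGroup E] (z : Fin m → E) :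
    z ∈ polyhedralProduct K (Metric.closedBall 0 1) (Metric.sphere 0 1) ↔
      ∃ σ ∈ insert ∅ K.faces, ∀ i, ‖z i‖ ≤ 1 ∧ (i ∉ σ → ‖z i‖ = 1) := by
  simp only [polyhedralProduct, Set.mem_iUnion, Set.mem_ofPred_eq, exists_prop,
    mem_closedBall_zero_iff, mem_sphere_zero_iff_norm]
  refine exists_congr fun σ => and_congr_right fun _ => forall_congr' fun i => ?_
  by_cases hi : i ∈ σ
  · simp [hi]
  · simpa [hi] using le_of_eq

variable (E : Type) [NormedAddCommGroup E] [NormedSpace ℝ E] [FiniteDimensional ℝ E] [Nontrivial E]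

theorem nonempty_cubeProduct_wedgeFamily_homeomorph_polyhedralProduct :
    Nonempty (cubeProduct (wedgeFamily (Fin (Module.finrank ℝ E)) (insert ∅ K.faces)) ≃ₜ
      polyhedralProduct K (Metric.closedBall (0 : E) 1) (Metric.sphere 0 1)) := by
  have : NeZero (Module.finrank ℝ E) := ⟨Module.finrank_pos.ne'⟩
  obtain ⟨g, hg₁, hg₂⟩ := exists_homeomorph_norm_le_one_iff_and_norm_eq_one_iff
    (Module.finBasis ℝ E).equivFunL
  let Φ : (Fin m × Fin (Module.finrank ℝ E) → ℝ) ≃ₜ (Fin m → E) :=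
    Homeomorph.piCurry.trans (Homeomorph.piCongrRight fun _ => g.symm)
  have hΦ (x i) : g (Φ x i) = fun j => x (i, j) := g.apply_symm_apply _
  refine ⟨Φ.subtype fun x => mem_cubeProduct_wedgeFamily.trans ?_⟩
  exact .trans (by simp only [← hg₁, ← hg₂, hΦ]) (mem_polyhedralProduct_iff K _).symm

theorem two_pow_le_totalHomologyDim_polyhedralProduct {σ : Finset (Fin m)}
    (hσ : σ ∈ insert ∅ K.faces) (hmax : ∀ ρ ∈ insert ∅ K.faces, σ ⊆ ρ → ρ = σ) :
    (2 : Cardinal.{u}) ^ σᶜ.card ≤ totalHomologyDim k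
      (polyhedralProduct K (Metric.closedBall (0 : E) 1) (Metric.sphere 0 1)) := by
  let j₀ : Fin (Module.finrank ℝ E) := ⟨0, Module.finrank_pos⟩
  obtain ⟨e⟩ := nonempty_cubeProduct_wedgeFamily_homeomorph_polyhedralProduct K E
  calc (2 : Cardinal.{u}) ^ σᶜ.card = 2 ^ ((σᶜ ×ˢ {j₀})ᶜᶜ : Finset (Fin m × _)).card := by
        rw [compl_compl, Finset.card_product, Finset.card_singleton, mul_one]
    _ ≤ totalHomologyDim k (cubeProduct (wedgeFamily _ (insert ∅ K.faces))) :=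
        two_pow_le_totalHomologyDim_cubeProduct k (compl_product_singleton_mem_wedgeFamily hσ j₀)
          fun _ => eq_compl_product_singleton_of_subset hmax j₀
    _ ≤ totalHomologyDim k
        (polyhedralProduct K (Metric.closedBall (0 : E) 1) (Metric.sphere 0 1)) :=
        totalHomologyDim_le_of_leftInverse k (f := e) (g := e.symm) e.left_inv

end PolyhedralProduct

section FreeActions

theorem card_le_card_of_injective_pi {G α β : Type*} [Group G] [Fintype α] [Fintype β] {p : ℕ}
    (hp : 1 < Nat.card {g : G // g ^ p = 1}) {f : (α → G) →* (β → G)}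
    (hf : Function.Injective f) : Fintype.card α ≤ Fintype.card β := by
  have : Finite {g : G // g ^ p = 1} := Nat.finite_of_card_ne_zero (by lia)
  let φ (x : α → {g : G // g ^ p = 1}) (b : β) : {g : G // g ^ p = 1} :=
    ⟨f (fun a => x a) b, by
      have hx : (fun a => (x a : G)) ^ p = 1 := funext fun a => (x a).2
      rw [← Pi.pow_apply, ← map_pow, hx, map_one, Pi.one_apply]⟩
  have hφ : Function.Injective φ := fun x y h => funext fun a => Subtype.ext <|
    congrFun (hf (funext fun b => congrArg Subtype.val (congrFun h b))) a
  have hcard := Nat.card_le_card_of_injective φ hφ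
  rwa [Nat.card_fun, Nat.card_fun, Nat.pow_le_pow_iff_right hp, Nat.card_eq_fintype_card,
    Nat.card_eq_fintype_card] at hcard

variable {m : ℕ} {K : PreAbstractSimplicialComplex (Fin m)} {E : Type*} [NormedAddCommGroup E]
  [NormedSpace ℝ E] [Nontrivial E] {G : Type*} [Group G] [DistribMulAction G E]
  {H : Subgroup (Fin m → G)} {σ : Finset (Fin m)}

theorem eq_one_of_free (hσ : σ ∈ insert ∅ K.faces)
    (hfree : ∀ h ∈ H, ∀ z ∈ polyhedralProduct K (Metric.closedBall (0 : E) 1) (Metric.sphere 0 1),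
      h • z = z → h = 1) {h : Fin m → G} (hH : h ∈ H) (hh : ∀ i ∉ σ, h i = 1) : h = 1 := by
  obtain ⟨u, hu⟩ := exists_norm_eq E zero_le_one
  refine hfree h hH (fun i => if i ∈ σ then 0 else u) ?_ (funext fun i => ?_)
  · refine (mem_polyhedralProduct_iff K _).2 ⟨σ, hσ, fun i => ?_⟩
    by_cases hi : i ∈ σ <;> simp [hi, hu]
  · by_cases hi : i ∈ σ <;> simp [hi, hh]

theorem le_card_compl_of_free {p r : ℕ} (hp : 1 < Nat.card {g : G // g ^ p = 1})
    (hσ : σ ∈ insert ∅ K.faces)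
    (hfree : ∀ h ∈ H, ∀ z ∈ polyhedralProduct K (Metric.closedBall (0 : E) 1) (Metric.sphere 0 1),
      h • z = z → h = 1) (e : H ≃* (Fin r → G)) : r ≤ σᶜ.card := by
  let ρ : H →* (↥σᶜ → G) :=
    (MonoidHom.pi fun i : ↥σᶜ => Pi.evalMonoidHom (fun _ => G) i.1).comp H.subtype
  have hρ : Function.Injective ρ := (injective_iff_map_eq_one ρ).2 fun h hh =>
    Subtype.ext <| eq_one_of_free hσ hfree h.2 fun i hi =>
      congrFun hh ⟨i, Finset.mem_compl.2 hi⟩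
  simpa [Finset.card_compl] using card_le_card_of_injective_pi hp
    (f := ρ.comp e.symm.toMonoidHom) (hρ.comp e.symm.injective)

end FreeActions

theorem exists_maximal_face {m : ℕ} (K : PreAbstractSimplicialComplex (Fin m)) :
    ∃ σ ∈ insert ∅ K.faces, ∀ ρ ∈ insert ∅ K.faces, σ ⊆ ρ → ρ = σ := by
  obtain ⟨σ, hσ⟩ := (Set.toFinite (insert ∅ K.faces)).exists_maximal ⟨∅, Set.mem_insert _ _⟩
  exact ⟨σ, hσ.1, fun ρ hρ h => (hσ.2 hρ h).antisymm h⟩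

theorem one_lt_card_sq_eq_one_circle : 1 < Nat.card {g : Circle // g ^ 2 = 1} := by
  have h : {g : Circle | g ^ 2 = 1} = {1, Circle.exp Real.pi} := by
    ext g
    simp only [Set.mem_ofPred_eq, Set.mem_insert_iff, Set.mem_singleton_iff, Circle.ext_iff,
      Circle.coe_pow, Circle.coe_one, Circle.coe_exp, Complex.exp_pi_mul_I, sq_eq_one_iff]
  have hne : (1 : Circle) ≠ Circle.exp Real.pi := by
    rw [Ne, Circle.ext_iff, Circle.coe_one, Circle.coe_exp, Complex.exp_pi_mul_I]
    norm_num
  change 1 < Set.ncard {g : Circle | g ^ 2 = 1}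
  rw [h, Set.ncard_pair hne]
  exact one_lt_two

theorem one_lt_card_sq_eq_one_intUnits : 1 < Nat.card {g : ℤˣ // g ^ 2 = 1} := by
  rw [Nat.card_eq_fintype_card]
  decide

theorem corollary1p4_general {m : ℕ} (K : PreAbstractSimplicialComplex (Fin m))
    (k : Type u) [Field k] (E : Type) [NormedAddCommGroup E] [NormedSpace ℝ E]
    [FiniteDimensional ℝ E] [Nontrivial E] {G : Type*} [Group G] [DistribMulAction G E] {p r : ℕ}
    (hp : 1 < Nat.card {g : G // g ^ p = 1}) (H : Subgroup (Fin m → G)) (e : H ≃* (Fin r → G))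
    (hfree : ∀ h ∈ H, ∀ z ∈ polyhedralProduct K (Metric.closedBall (0 : E) 1) (Metric.sphere 0 1),
      h • z = z → h = 1) :
    (2 : Cardinal.{u}) ^ r ≤ totalCohomologyDim k
      (polyhedralProduct K (Metric.closedBall (0 : E) 1) (Metric.sphere 0 1)) := by
  obtain ⟨σ, hσ, hmax⟩ := exists_maximal_face K
  calc (2 : Cardinal.{u}) ^ r ≤ 2 ^ σᶜ.card :=
        pow_le_pow_right₀ one_le_two (le_card_compl_of_free hp hσ hfree e)
    _ ≤ totalHomologyDim k _ := two_pow_le_totalHomologyDim_polyhedralProduct k K E hσ hmax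
    _ ≤ totalCohomologyDim k _ := totalHomologyDim_le_totalCohomologyDim k _

end

theorem corollary1p4 {m : ℕ} (K : PreAbstractSimplicialComplex (Fin m))
    (k : Type u) [Field k] (r : ℕ) :
    (∀ H : Subgroup (Fin m → Circle), Nonempty (H ≃ₜ* (Fin r → Circle)) →
      (∀ (h : H) (z : momentAngle K), h • z = z → h = 1) →
      (2 : Cardinal.{u}) ^ r ≤ totalCohomologyDim k (momentAngle K)) ∧
    (∀ H : Subgroup (Fin m → ℤˣ), Nonempty (H ≃* (Fin r → ℤˣ)) →
      (∀ (h : H) (x : realMomentAngle K), h • x = x → h = 1) →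
      (2 : Cardinal.{u}) ^ r ≤ totalCohomologyDim k (realMomentAngle K)) :=
  ⟨fun H ⟨e⟩ hfree => corollary1p4_general K k ℂ one_lt_card_sq_eq_one_circle H e.toMulEquiv
      fun h hh z hz hhz => congrArg Subtype.val (hfree ⟨h, hh⟩ ⟨z, hz⟩ (Subtype.ext hhz)),
    fun H ⟨e⟩ hfree => corollary1p4_general K k ℝ one_lt_card_sq_eq_one_intUnits H e
      fun h hh z hz hhz => congrArg Subtype.val (hfree ⟨h, hh⟩ ⟨z, hz⟩ (Subtype.ext hhz))⟩
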